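/- **Theorem 1.1.** Let $\Delta\subset\mathbb C$ be a simply connected domain, let $\psi$ be analytic in $\Delta$, let $u\in\mathbb C\setminus\{0\}$, and let $n\ge 1$ be an integer. Define functions in $\Delta$ by $$F_1=\tfrac12\psi,\qquad F_2=-\tfrac14\psi',\qquad F_{s+1}=-\tfrac12F_s'-\tfrac12\sum_{j=1}^{s-1}F_jF_{s-j}\quad(s\ge 2),$$ let $E_s$ ($s\ge1$) be any antiderivatives of $F_s$ in $\Delta$, and for $v\neq0$ put $$S_n(v,\xi)=\sum_{s=1}^{n-1}\frac{E_s(\xi)}{v^s},\qquad T_n(v,\xi)=v\frac{\partial S_n(v,\xi)}{\partial\xi}=\sum_{s=0}^{n-2}\frac{F_{s+1}(\xi)}{v^s},$$ $$\chi_n(v,\xi)=2F_n(\xi)-\sum_{s=1}^{n-1}\frac{G_{n,s}(\xi)}{v^s},\qquad G_{n,s}(\xi)=\sum_{k=s}^{n-1}F_k(\xi)F_{s+n-k-1}(\xi).$$ An $R_2$ arc is an arc with a twice continuously differentiable parametrization whose derivative does not vanish. For $j=1,2$ let $\alpha_j$ be either a point of $\Delta$, or the point at infinity on an infinite $R_2$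 arc $\ell_j$ in $\Delta$ (parametrized by $[0,\infty)$ and tending to $\infty$); in the latter case assume that $\int_{\ell_j}|\chi_n(\pm u,t)\,dt|$ and $\int_{\ell_j}|T_n(\pm u,t)\,dt|$ converge (upper sign for $j=1$, lower sign for $j=2$). A *progressive path* $\mathcal L_j$ from $\alpha_j$ to $\xi\in\Delta$ is a path in $\Delta$ that consists of a finite chain of $R_2$ arcs (when $\alpha_j$ is at infinity, preceded by a final portion of $\ell_j$, traversed from infinity), such that $\operatorname{Re}\{(-1)^jut\}$ is nonincreasing as $t$ passes along $\mathcal L_j$ from $\alpha_j$ to $\xi$. Let $\Xi_j(u,\alpha_j)$ be the set of $\xi\in\Delta$ for which such a path exists. Then the equation $$\frac{d^2W}{d\xi^2}=\{u^2+\psi(\xi)\}W$$ has solutions, holomorphic in $\Delta$, of the form $$W_{n,1}(u,\xi)=\exp\{S_n(u,\xi)\}\{e^{u\xi}+\varepsilon_{n,1}(u,\xi)\},\qquad W_{n,2}(u,\xi)=\exp\{S_n(-u,\xi)\}\{e^{-u\xi}+\varepsilon_{n,2}(u,\xi)\},$$ such that for $j=1,2$, every $\xi\in\Xi_j(u,\alpha_j)$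 and every progressive path $\mathcal L_j$ from $\alpha_j$ to $\xi$, $$\left|\varepsilon_{n,j}(u,\xi)\right|,\ \left|\frac1u\frac{\partial\varepsilon_{n,j}(u,\xi)}{\partial\xi}\right|\le\left|\frac{e^{\pm u\xi}}{u^n}\right|\int_{\mathcal L_j}|\chi_n(\pm u,t)\,dt|\ \exp\left\{\frac4{|u|}\int_{\mathcal L_j}|T_n(\pm u,t)\,dt|+\frac1{|u|^n}\int_{\mathcal L_j}|\chi_n(\pm u,t)\,dt|\right\},$$ with the upper signs for $j=1$ and the lower signs for $j=2$. -/

import Mathlib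

open Set Filter MeasureTheory

namespace LiouvilleGreen

/-! ### The coefficients -/

/-- The coefficient functions `F_s`, `s ≥ 1` (the value at `s = 0` is never used):
`F_1 = ψ / 2`, `F_2 = - ψ' / 4`, and
`F_{s+1} = - (1/2) F_s' - (1/2) ∑_{j=1}^{s-1} F_j F_{s-j}` for `s ≥ 2`
(in the last clause the shifts are `s = r + 2` and `j = i + 1`). -/
noncomputable def F (ψ : ℂ → ℂ) : ℕ → ℂ → ℂ
  | 0 => fun _ => 0
  | 1 => fun ξ => (1 / 2 : ℂ) * ψ ξ
  | 2 => fun ξ => -(1 / 4 : ℂ) * deriv ψ ξ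
  | r + 3 => fun ξ =>
      -(1 / 2 : ℂ) * deriv (F ψ (r + 2)) ξ
        - (1 / 2 : ℂ) * ∑ i : Fin (r + 1), F ψ (i + 1) ξ * F ψ (r + 1 - i) ξ
  termination_by s => s
  decreasing_by all_goals omega

/-- `S_n(u, ξ) = ∑_{s=1}^{n-1} E_s(ξ) / u^s`. -/
noncomputable def S (E : ℕ → ℂ → ℂ) (n : ℕ) (u ξ : ℂ) : ℂ :=
  ∑ s ∈ Finset.Icc 1 (n - 1), E s ξ / u ^ s

/-- `T_n(u, ξ) = ∑_{s=0}^{n-2} F_{s+1}(ξ) / u^s` (the empty sum for `n = 1`). -/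
noncomputable def T (ψ : ℂ → ℂ) (n : ℕ) (u ξ : ℂ) : ℂ :=
  ∑ s ∈ Finset.range (n - 1), F ψ (s + 1) ξ / u ^ s

/-- `G_{n,s}(ξ) = ∑_{k=s}^{n-1} F_k(ξ) F_{s+n-k-1}(ξ)`. -/
noncomputable def G (ψ : ℂ → ℂ) (n s : ℕ) (ξ : ℂ) : ℂ :=
  ∑ k ∈ Finset.Icc s (n - 1), F ψ k ξ * F ψ (s + n - k - 1) ξ

/-- `χ_n(u, ξ) = 2 F_n(ξ) - ∑_{s=1}^{n-1} G_{n,s}(ξ) / u^s`. -/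
noncomputable def chi (ψ : ℂ → ℂ) (n : ℕ) (u ξ : ℂ) : ℂ :=
  2 * F ψ n ξ - ∑ s ∈ Finset.Icc 1 (n - 1), G ψ n s ξ / u ^ s

/-- `W` is a holomorphic solution of `W'' = (u² + ψ(ξ)) W` in the open set `Δ`. -/
def IsSolution (Δ : Set ℂ) (ψ : ℂ → ℂ) (u : ℂ) (W : ℂ → ℂ) : Prop :=
  DifferentiableOn ℂ W Δ ∧ ∀ ξ ∈ Δ, deriv (deriv W) ξ = (u ^ 2 + ψ ξ) * W ξ

/-! ### Paths -/

/-- An `R₂` arc: a twice continuously differentiable parametrized arc with nowhere vanishing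
derivative. (Simplicity is not required; a chain of such arcs can always be
subdivided into a finite chain of simple ones.) -/
structure R2Arc where
  toFun : ℝ → ℂ
  contDiffOn : ContDiffOn ℝ 2 toFun (Icc 0 1)
  deriv_ne_zero : ∀ τ ∈ Icc (0 : ℝ) 1, derivWithin toFun (Icc 0 1) τ ≠ 0

/-- The integral `∫ |g(t) dt|` along an `R₂` arc. -/
noncomputable def R2Arc.absIntegral (γ : R2Arc) (g : ℂ → ℂ) : ℝ :=
  ∫ τ in Icc (0 : ℝ) 1, ‖g (γ.toFun τ)‖ * ‖derivWithin γ.toFun (Icc 0 1) τ‖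

/-- An `R₂` arc going to infinity. -/
structure InfiniteR2Arc where
  toFun : ℝ → ℂ
  contDiffOn : ContDiffOn ℝ 2 toFun (Ici 0)
  deriv_ne_zero : ∀ τ ∈ Ici (0 : ℝ), derivWithin toFun (Ici 0) τ ≠ 0
  tendsto_infinity : Tendsto toFun atTop (Bornology.cobounded ℂ)

/-- The integrand of `∫ |g(t) dt|` along an infinite `R₂` arc. -/
noncomputable def InfiniteR2Arc.integrand (ℒ : InfiniteR2Arc) (g : ℂ → ℂ) (τ : ℝ) : ℝ :=
  ‖g (ℒ.toFun τ)‖ * ‖derivWithin ℒ.toFun (Ici 0) τ‖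

/-- A reference point: a finite point, or the point at infinity on an infinite
`R₂` arc (paths issuing from it coincide with that arc near infinity). -/
inductive BasePoint where
  | point (α : ℂ)
  | infinity (ℒ : InfiniteR2Arc)

/-- The reference point is a point of `Δ`, or the point at infinity on an arc lying in `Δ`. -/
def BasePoint.IsIn (Δ : Set ℂ) : BasePoint → Prop
  | .point α => α ∈ Δ
  | .infinity ℒ => ∀ τ ∈ Ici (0 : ℝ), ℒ.toFun τ ∈ Δ

/-- `∫ |g(t) dt|` converges at the reference point (no condition at a finite point). -/
def BasePoint.Converges (g : ℂ → ℂ) : BasePoint → Prop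
  | .point _ => True
  | .infinity ℒ => IntegrableOn (ℒ.integrand g) (Ici 0)

/-- `IsProgressiveChain Δ j u p l q`: the list `l` is a finite chain of `R₂` arcs in `Δ` leading
from `p` to `q`, along which the real part of `(-1)^j u t` is nonincreasing. -/
def IsProgressiveChain (Δ : Set ℂ) (j : ℕ) (u : ℂ) : ℂ → List R2Arc → ℂ → Prop
  | p, [], q => p = q
  | p, γ :: l, q =>
      γ.toFun 0 = p ∧ (∀ τ ∈ Icc (0 : ℝ) 1, γ.toFun τ ∈ Δ) ∧
      AntitoneOn (fun τ => ((-1 : ℂ) ^ j * u * γ.toFun τ).re) (Icc 0 1) ∧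
      IsProgressiveChain Δ j u (γ.toFun 1) l q

/-- Progressive paths in `Δ` linking a reference point `α_j` with `ξ`. From the point at
infinity on `ℒ` such a path first follows `ℒ` backwards from `∞` to some point `ℒ(τ₀)`, so
that the real part of `(-1)^j u ℒ(τ)` must be a nondecreasing function of `τ ≥ τ₀`. -/
inductive ProgressivePath (Δ : Set ℂ) (j : ℕ) (u : ℂ) : BasePoint → ℂ → Type
  | fromPoint (α ξ : ℂ) (arcs : List R2Arc)
      (chain : IsProgressiveChain Δ j u α arcs ξ) :
      ProgressivePath Δ j u (BasePoint.point α) ξ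
  | fromInfinity (ℒ : InfiniteR2Arc) (ξ : ℂ) (τ₀ : ℝ) (nonneg : 0 ≤ τ₀)
      (mem : ∀ τ ∈ Ici τ₀, ℒ.toFun τ ∈ Δ)
      (mono : MonotoneOn (fun τ => ((-1 : ℂ) ^ j * u * ℒ.toFun τ).re) (Ici τ₀))
      (arcs : List R2Arc)
      (chain : IsProgressiveChain Δ j u (ℒ.toFun τ₀) arcs ξ) :
      ProgressivePath Δ j u (BasePoint.infinity ℒ) ξ

/-- The integral `∫_{α_j}^ξ |g(t) dt|` taken along a progressive path. -/
noncomputable def ProgressivePath.absIntegral {Δ : Set ℂ} {j : ℕ} {u : ℂ} {α : BasePoint} {ξ : ℂ}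
    (L : ProgressivePath Δ j u α ξ) (g : ℂ → ℂ) : ℝ :=
  match L with
  | .fromPoint _ _ arcs _ => (arcs.map fun γ => γ.absIntegral g).sum
  | .fromInfinity ℒ _ τ₀ _ _ _ arcs _ =>
      (∫ τ in Ici τ₀, ℒ.integrand g τ) + (arcs.map fun γ => γ.absIntegral g).sum

/-- The point set `Ξ_j(u, α_j)`. -/
def Xi (Δ : Set ℂ) (j : ℕ) (u : ℂ) (α : BasePoint) : Set ℂ :=
  {ξ | ξ ∈ Δ ∧ Nonempty (ProgressivePath Δ j u α ξ)}

end LiouvilleGreen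

namespace LiouvilleGreen
open Topology

/-! ### Holomorphic linear equations on simply connected domains -/

/-! Write `v = ±u`. Inserting `exp (v ξ + S)` in the equation gives a Riccati equation for the
logarithmic derivative `v + T / v`. The recursion for `F` annihilates its coefficients of `v⁻ˢ` for
`s < n`, apart from one leftover of order `v⁻⁽ⁿ⁻¹⁾`: the residual is exactly `-χ / v ^ (n - 1)`
(`residual_eq`).

For a solution `w = e^S (e^{vξ} + ε)` put `p, q = e^{-vξ} (ε ± ε' / v)`. The equation becomes `p' =
g`, `q' = -2vq - g`, where `g` is linear in `p, q` with coefficients controlled by `T / v` and `χ /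
v ^ n`, plus the forcing `χ / v ^ n`. On a progressive path `Re (v t)` is nondecreasing, so the term
`-2vq` can only damp `q`; Grönwall's inequality (`arc_bound`, `Setting.errSize_arc`) bounds `max |p|
|q|`, which dominates both `e^{-vξ} ε` and `e^{-vξ} ε' / v`. Such bounds compose along chains
(`add_mul_exp_trans`).

At a finite reference point take the solution with `ε = ε' = 0` there. At infinity take the
solutions whose error vanishes at `ℒ k`, `k = 0, 1, 2, …`: their bounds do not depend on `k`, so
their Cauchy data at one reachable point have a convergent subsequence, and the limiting solution
inherits every estimate.

Holomorphic solutions on all of `Δ` come from local power-type iteration and monodromy: Cauchy data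
form a local system, which has global sections on a simply connected domain (`exists_solvesOn`). -/

/-- On a simply connected space a flat family of bijections has a global horizontal section. -/
theorem exists_flat_section {X F : Type*} [TopologicalSpace X] [SimplyConnectedSpace X]
    [LocallyPathConnectedSpace X] (B : X → Set X) (hB : ∀ i, IsOpen (B i)) (hm : ∀ x, x ∈ B x)
    (ev : X → X → F ≃ F) (hev : ∀ x, ev x x = Equiv.refl F)
    (hloc : ∀ i j v, ∀ x ∈ B i ∩ B j,
      ∀ᶠ y in 𝓝 x, (ev j y).symm (ev i y v) = (ev j x).symm (ev i x v)) (x₀ : X) (v₀ : F) :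
    ∃ s : X → F, s x₀ = v₀ ∧ ∀ i, ∀ᶠ y in 𝓝 i, s y = ev i y (s i) := by
  -- With the discrete topology on the fibre, `hloc` says precisely that the coordinate changes are
  -- continuous, and the resulting bundle is a covering. The section is the lift of the identity.
  let _ : TopologicalSpace F := ⊥
  have : DiscreteTopology F := ⟨rfl⟩
  let Z : FiberBundleCore X X F :=
    { baseSet := B
      isOpen_baseSet := hB
      indexAt := id
      mem_baseSet_at := hm
      coordChange := fun i j x v => (ev j x).symm (ev i x v)
      coordChange_self := by simp
      continuousOn_coordChange := by
        rintro i j ⟨x, v⟩ ⟨hx, -⟩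
        apply ContinuousAt.continuousWithinAt
        have h1 : ∀ᶠ p : X × F in 𝓝 (x, v), p.2 = v := by
          have h : Tendsto (Prod.snd : X × F → F) (𝓝 (x, v)) (𝓝 v) := continuous_snd.tendsto _
          exact h.eventually (p := fun w => w = v) (by simp)
        have h2 : Tendsto (Prod.fst : X × F → X) (𝓝 (x, v)) (𝓝 x) := continuous_fst.tendsto _
        replace h2 := h2.eventually (hloc i j v x hx)
        refine (continuousAt_const (y := (ev j x).symm (ev i x v))).congr ?_
        filter_upwards [h1, h2] with p hp1 hp2
        rw [hp1]; exact hp2.symm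
      coordChange_comp := by simp }
  have cov : IsCoveringMap (Bundle.TotalSpace.proj : Bundle.TotalSpace F Z.Fiber → X) :=
    FiberBundle.isCoveringMap
  obtain ⟨f, ⟨hf0, hf⟩, -⟩ := cov.existsUnique_continuousMap_lifts
    (ContinuousMap.id X) x₀ ⟨x₀, v₀⟩ rfl
  have hproj : ∀ x, (f x).proj = x := fun x => congrFun hf x
  have hs : ∀ x, ∃ v : F, f x = ⟨x, v⟩ := by
    intro x
    have := hproj x
    rcases hfx : f x with ⟨y, v⟩
    rw [hfx] at this
    subst this
    exact ⟨v, rfl⟩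
  choose s hs using hs
  refine ⟨s, ?_, fun i => ?_⟩
  · have := hs x₀
    rw [hf0] at this
    injection this with _ h
    exact h.symm
  · have hi : f i ∈ (Z.localTriv i).source := by
      rw [Z.mem_localTriv_source, hproj]; exact hm i
    have hc : ContinuousAt (fun y => (Z.localTriv i (f y)).2) i :=
      (continuous_snd.continuousAt).comp
        (((Z.localTriv i).continuousAt hi).comp f.continuous.continuousAt)
    -- A continuous map into a discrete fibre is locally constant.
    have h1 : ∀ᶠ y in 𝓝 i, (Z.localTriv i (f y)).2 = (Z.localTriv i (f i)).2 :=
      hc.eventually (p := fun w => w = (Z.localTriv i (f i)).2) (by simp)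
    filter_upwards [h1] with y hy
    rw [hs y, hs i] at hy
    simp only [Z.localTriv_apply] at hy
    change (ev i y).symm (ev y y (s y)) = (ev i i).symm (ev i i (s i)) at hy
    simpa [hev, Equiv.symm_apply_eq] using hy

/-- Local existence for holomorphic linear systems. -/
theorem exists_local_solution {V : Type*} [NormedAddCommGroup V] [NormedSpace ℂ V]
    [CompleteSpace V] {U : Set ℂ} (hU : IsOpen U) {A : ℂ → V →L[ℂ] V}
    (hA : DifferentiableOn ℂ A U) {c : ℂ} (hc : c ∈ U) :
    ∃ r > 0, Metric.ball c r ⊆ U ∧ ∀ y₀ : V, ∃ y : ℂ → V, y c = y₀ ∧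
      ∀ z ∈ Metric.ball c r, HasDerivAt y (A z (y z)) z := by
  set M : ℝ := ‖A c‖ + 1 with hM
  have hMpos : 0 < M := by positivity
  have hAc : ContinuousAt A c := (hA.continuousOn.continuousAt (hU.mem_nhds hc))
  have h1 : ∀ᶠ z in 𝓝 c, ‖A z‖ < M ∧ z ∈ U :=
    (hAc.norm.eventually (gt_mem_nhds (by rw [hM]; linarith))).and (hU.mem_nhds hc)
  obtain ⟨r₀, hr₀, hball⟩ := Metric.eventually_nhds_iff_ball.1 h1
  -- Small enough that integrating `A z (g z)` from `c` at least halves a sup-norm bound.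
  set r : ℝ := min r₀ (1 / (2 * M)) with hr
  have hrpos : 0 < r := by positivity
  have hrM : M * r ≤ 1 / 2 := by
    calc M * r ≤ M * (1 / (2 * M)) := by gcongr; exact min_le_right _ _
      _ = 1 / 2 := by field_simp
  have hb : ∀ z ∈ Metric.ball c r, ‖A z‖ < M ∧ z ∈ U := fun z hz =>
    hball z (Metric.ball_subset_ball (min_le_left _ _) hz)
  have hAb : DifferentiableOn ℂ A (Metric.ball c r) := hA.mono fun z hz => (hb z hz).2
  have hcb : c ∈ Metric.ball c r := Metric.mem_ball_self hrpos
  refine ⟨r, hrpos, fun z hz => (hb z hz).2, fun y₀ => ?_⟩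
  have hP : ∀ g : ℂ → V, ∃ G : ℂ → V, DifferentiableOn ℂ g (Metric.ball c r) →
      G c = 0 ∧ ∀ z ∈ Metric.ball c r, HasDerivAt G (A z (g z)) z := by
    intro g
    by_cases hg : DifferentiableOn ℂ g (Metric.ball c r)
    · obtain ⟨G, hG⟩ := (hAb.clm_apply hg).isExactOn_ball.with_val_at c 0
      exact ⟨G, fun _ => ⟨hG.1, hG.2⟩⟩
    · exact ⟨0, fun h => absurd h hg⟩
  choose P hP using hP
  -- These are the increments of the Picard iteration; the solution is their sum.
  let g : ℕ → ℂ → V := fun m => Nat.rec (fun _ => y₀) (fun _ h => P h) m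
  have hg0 : g 0 = fun _ => y₀ := rfl
  have hgs : ∀ m, g (m + 1) = P (g m) := fun _ => rfl
  have hgd : ∀ m, DifferentiableOn ℂ (g m) (Metric.ball c r) := by
    intro m
    induction m with
    | zero => exact differentiableOn_const _
    | succ m ih =>
      intro z hz
      rw [hgs]
      exact ((hP _ ih).2 z hz).differentiableAt.differentiableWithinAt
  have hgb : ∀ m, ∀ z ∈ Metric.ball c r, ‖g m z‖ ≤ ‖y₀‖ * (1 / 2) ^ m := by
    intro m
    induction m with
    | zero => intro z _; simp [hg0]
    | succ m ih =>
      intro z hz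
      have hd := hP _ (hgd m)
      have := (convex_ball c r).norm_image_sub_le_of_norm_hasDerivWithin_le
        (f := P (g m)) (C := M * (‖y₀‖ * (1 / 2) ^ m))
        (fun x hx => (hd.2 x hx).hasDerivWithinAt)
        (fun x hx => ((A x).le_opNorm _).trans
          (mul_le_mul (hb x hx).1.le (ih x hx) (norm_nonneg _) hMpos.le)) hcb hz
      rw [hd.1, sub_zero] at this
      rw [hgs]
      have hz' : ‖z - c‖ ≤ r := by rw [← dist_eq_norm]; exact (Metric.mem_ball.1 hz).le
      calc _ ≤ _ := this
        _ ≤ M * (‖y₀‖ * (1 / 2) ^ m) * r := by gcongr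
        _ = (M * r) * (‖y₀‖ * (1 / 2) ^ m) := by ring
        _ ≤ (1 / 2) * (‖y₀‖ * (1 / 2) ^ m) := by gcongr
        _ = _ := by ring
  have hsum : Summable fun m : ℕ => ‖y₀‖ * (1 / 2 : ℝ) ^ m :=
    (summable_geometric_of_lt_one (by norm_num) (by norm_num)).mul_left _
  refine ⟨fun z => ∑' m, g m z, ?_, fun z hz => ?_⟩
  · change ∑' m, g m c = y₀
    refine (tsum_eq_single 0 fun m hm => ?_).trans rfl
    obtain ⟨k, rfl⟩ := Nat.exists_eq_succ_of_ne_zero hm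
    exact (hP _ (hgd k)).1
  · have hs := Complex.hasSum_deriv_of_summable_norm hsum hgd Metric.isOpen_ball hgb hz
    have hd := (Complex.differentiableOn_tsum_of_summable_norm hsum hgd Metric.isOpen_ball hgb).differentiableAt
      (Metric.isOpen_ball.mem_nhds hz)
    have hgz : Summable fun m => g m z := Summable.of_norm_bounded hsum fun m => hgb m z hz
    have h2 : HasSum (fun m => deriv (g m) z) (A z (∑' m, g m z)) := by
      rw [← hasSum_nat_add_iff' 1]
      simp only [Finset.range_one, Finset.sum_singleton, hg0, deriv_const, sub_zero]
      have := (A z).hasSum hgz.hasSum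
      refine this.congr_fun fun m => ?_
      rw [hgs, ((hP _ (hgd m)).2 z hz).deriv]
    rw [← hs.unique h2]
    exact hd.hasDerivAt

/-! ### Second-order equations: Wronskians, local fundamental pairs, monodromy -/

/-- `w` solves `w'' = Q w` on `U`, with derivative `w'`. -/
def SolvesOn (U : Set ℂ) (Q w w' : ℂ → ℂ) : Prop :=
  ∀ z ∈ U, HasDerivAt w (w' z) z ∧ HasDerivAt w' (Q z * w z) z

theorem SolvesOn.mono {U U' : Set ℂ} {Q w w' : ℂ → ℂ} (h : SolvesOn U Q w w') (hU : U' ⊆ U) :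
    SolvesOn U' Q w w' := fun z hz => h z (hU hz)

theorem SolvesOn.combo {U : Set ℂ} {Q w w' v v' : ℂ → ℂ} (hw : SolvesOn U Q w w')
    (hv : SolvesOn U Q v v') (a b : ℂ) :
    SolvesOn U Q (fun z => a * w z + b * v z) (fun z => a * w' z + b * v' z) := fun z hz =>
  ⟨((hw z hz).1.const_mul a).add ((hv z hz).1.const_mul b),
    (((hw z hz).2.const_mul a).add ((hv z hz).2.const_mul b)).congr_deriv (by ring)⟩

/-- The equation has no first-order term, so the Wronskian has zero derivative. This constancy
serves below in place of a uniqueness theorem. -/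
theorem SolvesOn.wronskian_eq {U : Set ℂ} (hU : IsOpen U) (hc : IsPreconnected U)
    {Q w w' v v' : ℂ → ℂ} (hw : SolvesOn U Q w w') (hv : SolvesOn U Q v v') {x y : ℂ}
    (hx : x ∈ U) (hy : y ∈ U) :
    w x * v' x - w' x * v x = w y * v' y - w' y * v y := by
  have h : ∀ z ∈ U, HasDerivAt (fun z => w z * v' z - w' z * v z) 0 z := fun z hz =>
    ((((hw z hz).1.mul (hv z hz).2).sub ((hw z hz).2.mul (hv z hz).1))).congr_deriv (by ring)
  exact hU.is_const_of_deriv_eq_zero hc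
    (fun z hz => (h z hz).differentiableAt.differentiableWithinAt) (fun z hz => (h z hz).deriv) hx hy

theorem exists_local_fundamental {U : Set ℂ} (hU : IsOpen U) {Q : ℂ → ℂ}
    (hQ : DifferentiableOn ℂ Q U) {c : ℂ} (hc : c ∈ U) :
    ∃ r > 0, Metric.ball c r ⊆ U ∧ ∃ a a' b b' : ℂ → ℂ,
      a c = 1 ∧ a' c = 0 ∧ b c = 0 ∧ b' c = 1 ∧
      SolvesOn (Metric.ball c r) Q a a' ∧ SolvesOn (Metric.ball c r) Q b b' := by
  let L₀ : ℂ × ℂ →L[ℂ] ℂ × ℂ :=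
    (ContinuousLinearMap.inl ℂ ℂ ℂ).comp (ContinuousLinearMap.snd ℂ ℂ ℂ)
  let L₁ : ℂ × ℂ →L[ℂ] ℂ × ℂ :=
    (ContinuousLinearMap.inr ℂ ℂ ℂ).comp (ContinuousLinearMap.fst ℂ ℂ ℂ)
  obtain ⟨r, hr, hrU, h⟩ := exists_local_solution hU (A := fun z => L₀ + Q z • L₁)
    ((differentiableOn_const _).add (hQ.smul_const _)) hc
  obtain ⟨y, hy0, hy⟩ := h (1, 0)
  obtain ⟨w, hw0, hw⟩ := h (0, 1)
  have key : ∀ y : ℂ → ℂ × ℂ,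
      (∀ z ∈ Metric.ball c r, HasDerivAt y ((L₀ + Q z • L₁) (y z)) z) →
      SolvesOn (Metric.ball c r) Q (fun z => (y z).1) (fun z => (y z).2) := by
    intro y hy z hz
    have h1 := (ContinuousLinearMap.fst ℂ ℂ ℂ).hasFDerivAt.comp_hasDerivAt z (hy z hz)
    have h2 := (ContinuousLinearMap.snd ℂ ℂ ℂ).hasFDerivAt.comp_hasDerivAt z (hy z hz)
    exact ⟨h1.congr_deriv (by simp [L₀, L₁]), h2.congr_deriv (by simp [L₀, L₁])⟩
  exact ⟨r, hr, hrU, _, _, _, _, by simp [hy0], by simp [hy0], by simp [hw0], by simp [hw0],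
    key y hy, key w hw⟩

/-- The local system has fibre the Cauchy data: `ev c x` transports data from `c` to `x` by the
fundamental pair at `c`, invertibly because its Wronskian is `1`. -/
theorem exists_solvesOn {Δ : Set ℂ} (hΔo : IsOpen Δ) (hΔ : IsSimplyConnected Δ) {Q : ℂ → ℂ}
    (hQ : DifferentiableOn ℂ Q Δ) {p : ℂ} (hp : p ∈ Δ) (d d' : ℂ) :
    ∃ w w' : ℂ → ℂ, w p = d ∧ w' p = d' ∧ SolvesOn Δ Q w w' := by
  have : SimplyConnectedSpace Δ := hΔ
  have : LocallyPathConnectedSpace Δ := hΔo.locallyPathConnectedSpace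
  choose r hr hrΔ a a' b b' ha ha' hb hb' hSa hSb using
    fun c : Δ => exists_local_fundamental hΔo hQ c.2
  have hwr : ∀ (c : Δ), ∀ x ∈ Metric.ball (c : ℂ) (r c), a c x * b' c x - a' c x * b c x = 1 := by
    intro c x hx
    rw [(hSa c).wronskian_eq Metric.isOpen_ball (convex_ball _ _).isPreconnected (hSb c) hx
      (Metric.mem_ball_self (hr c)), ha, ha', hb, hb']
    ring
  have hev : ∀ c x : Δ, ∃ e : ℂ × ℂ ≃ ℂ × ℂ, (x : ℂ) ∈ Metric.ball (c : ℂ) (r c) →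
      (∀ v, e v = (v.1 * a c x + v.2 * b c x, v.1 * a' c x + v.2 * b' c x)) ∧
      ∀ w, e.symm w = (w.1 * b' c x - w.2 * b c x, w.2 * a c x - w.1 * a' c x) := by
    intro c x
    by_cases hx : (x : ℂ) ∈ Metric.ball (c : ℂ) (r c)
    · have hW := hwr c x hx
      refine ⟨⟨fun v => (v.1 * a c x + v.2 * b c x, v.1 * a' c x + v.2 * b' c x),
        fun w => (w.1 * b' c x - w.2 * b c x, w.2 * a c x - w.1 * a' c x), ?_, ?_⟩,
        fun _ => ⟨fun _ => rfl, fun _ => rfl⟩⟩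
      · rintro ⟨v, w⟩
        ext
        · linear_combination v * hW
        · linear_combination w * hW
      · rintro ⟨v, w⟩
        ext
        · linear_combination v * hW
        · linear_combination w * hW
    · exact ⟨Equiv.refl _, fun h => absurd h hx⟩
  choose ev hev using fun c x => hev c x
  obtain ⟨s, hs0, hs⟩ := exists_flat_section (X := Δ)
    (fun c => Subtype.val ⁻¹' Metric.ball (c : ℂ) (r c))
    (fun c => Metric.isOpen_ball.preimage continuous_subtype_val)
    (fun c => Metric.mem_ball_self (hr c)) ev
    (fun c => Equiv.ext fun v => by
      rw [(hev c c (Metric.mem_ball_self (hr c))).1, ha, ha', hb, hb']; simp)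
    -- The coordinates of a solution in the pair at `j` are its Wronskians with that pair, hence
    -- constant on a ball inside the overlap.
    (fun i j v x hx => by
      obtain ⟨ρ, hρ, hρs⟩ := Metric.isOpen_iff.1
        ((Metric.isOpen_ball (x := (i : ℂ)) (ε := r i)).inter
          (Metric.isOpen_ball (x := (j : ℂ)) (ε := r j))) x hx
      have hmem : ∀ᶠ y : Δ in 𝓝 x, (y : ℂ) ∈ Metric.ball (x : ℂ) ρ :=
        continuous_subtype_val.continuousAt.eventually (Metric.ball_mem_nhds _ hρ)
      filter_upwards [hmem] with y hy
      have hf := (((hSa i).combo (hSb i) v.1 v.2).mono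
        (fun z hz => (hρs hz).1 : Metric.ball (x : ℂ) ρ ⊆ _))
      have hρj : Metric.ball (x : ℂ) ρ ⊆ Metric.ball (j : ℂ) (r j) := fun z hz => (hρs hz).2
      have hc := (convex_ball (x : ℂ) ρ).isPreconnected
      have h1 := hf.wronskian_eq Metric.isOpen_ball hc ((hSa j).mono hρj) hy
        (Metric.mem_ball_self hρ)
      have h2 := hf.wronskian_eq Metric.isOpen_ball hc ((hSb j).mono hρj) hy
        (Metric.mem_ball_self hρ)
      rw [(hev j y (hρs hy).2).2, (hev i y (hρs hy).1).1, (hev j x hx.2).2, (hev i x hx.1).1]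
      ext
      · exact h2
      · simp only
        linear_combination -h1)
    ⟨p, hp⟩ (d, d')
  have hloc : ∀ z (hz : z ∈ Δ), ∀ᶠ y in 𝓝 z, ∃ h : y ∈ Δ,
      s ⟨y, h⟩ = ((s ⟨z, hz⟩).1 * a ⟨z, hz⟩ y + (s ⟨z, hz⟩).2 * b ⟨z, hz⟩ y,
        (s ⟨z, hz⟩).1 * a' ⟨z, hz⟩ y + (s ⟨z, hz⟩).2 * b' ⟨z, hz⟩ y) := by
    intro z hz
    have h1 : 𝓝 z = map Subtype.val (𝓝 (⟨z, hz⟩ : Δ)) :=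
      (hΔo.isOpenEmbedding_subtypeVal.map_nhds_eq ⟨z, hz⟩).symm
    rw [h1, eventually_map]
    have hmem : ∀ᶠ y : Δ in 𝓝 ⟨z, hz⟩, (y : ℂ) ∈ Metric.ball z (r ⟨z, hz⟩) :=
      continuous_subtype_val.continuousAt.eventually (Metric.ball_mem_nhds _ (hr _))
    filter_upwards [hs ⟨z, hz⟩, hmem] with y hy hyb
    exact ⟨y.2, hy.trans ((hev ⟨z, hz⟩ y hyb).1 _)⟩
  classical
  refine ⟨fun z => if h : z ∈ Δ then (s ⟨z, h⟩).1 else 0,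
    fun z => if h : z ∈ Δ then (s ⟨z, h⟩).2 else 0, by simp [hp, hs0], by simp [hp, hs0],
    fun z hz => ?_⟩
  have hsol := (hSa ⟨z, hz⟩).combo (hSb ⟨z, hz⟩) (s ⟨z, hz⟩).1 (s ⟨z, hz⟩).2 z
    (Metric.mem_ball_self (hr _))
  have he := (hloc z hz).self_of_nhds
  obtain ⟨_, he⟩ := he
  constructor
  · refine (hsol.1.congr_of_eventuallyEq ?_).congr_deriv ?_
    · filter_upwards [hloc z hz] with y ⟨hy, h⟩
      simp only [hy, dite_true, h]
    · simp only [hz, dite_true]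
      exact (congrArg Prod.snd he).symm
  · refine (hsol.2.congr_of_eventuallyEq ?_).congr_deriv ?_
    · filter_upwards [hloc z hz] with y ⟨hy, h⟩
      simp only [hy, dite_true, h]
    · simp only [hz, dite_true]
      exact congrArg (Q z * ·) (congrArg Prod.fst he).symm

/-! ### Growth estimates along arcs -/

theorem continuousOn_and_hasDerivAt_primitive {f : ℝ → ℝ} {a b : ℝ} (hab : a ≤ b)
    (hf : ContinuousOn f (Icc a b)) :
    ContinuousOn (fun s => ∫ t in a..s, f t) (Icc a b) ∧
      ∀ s ∈ Ioo a b, HasDerivAt (fun s => ∫ t in a..s, f t) (f s) s := by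
  refine ⟨?_, fun s hs => ?_⟩
  · have := intervalIntegral.continuousOn_primitive_interval (μ := volume) (f := f) (a := a) (b := b)
      (by rw [uIcc_of_le hab]; exact hf.integrableOn_Icc)
    rwa [uIcc_of_le hab] at this
  · refine intervalIntegral.integral_hasDerivAt_right ?_ ?_ ?_
    · exact (hf.mono (Icc_subset_Icc_right hs.2.le)).intervalIntegrable_of_Icc hs.1.le
    · exact (hf.mono Ioo_subset_Icc_self).stronglyMeasurableAtFilter isOpen_Ioo s hs
    · exact hf.continuousAt (Icc_mem_nhds hs.1 hs.2)

/-- Grönwall's inequality in integral form, with a forcing term. -/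
theorem gronwall_integral {α β M : ℝ → ℝ} {M₀ a b : ℝ} (hab : a ≤ b)
    (hα : ContinuousOn α (Icc a b)) (hβ : ContinuousOn β (Icc a b)) (hM : ContinuousOn M (Icc a b))
    (hα0 : ∀ t ∈ Icc a b, 0 ≤ α t) (hβ0 : ∀ t ∈ Icc a b, 0 ≤ β t)
    (h : ∀ s ∈ Icc a b, M s ≤ M₀ + ∫ t in a..s, (α t + β t * M t)) :
    M b ≤ (M₀ + ∫ t in a..b, α t) * Real.exp (∫ t in a..b, β t) := by
  obtain ⟨hc1, hd1⟩ := continuousOn_and_hasDerivAt_primitive hab (hα.add (hβ.mul hM))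
  obtain ⟨hc2, hd2⟩ := continuousOn_and_hasDerivAt_primitive hab hα
  obtain ⟨hc3, hd3⟩ := continuousOn_and_hasDerivAt_primitive hab hβ
  simp only [Pi.add_apply, Pi.mul_apply] at hc1 hd1
  set N : ℝ → ℝ := fun s => M₀ + ∫ t in a..s, (α t + β t * M t) with hN
  -- With `N` the right-hand side of `h` and `e = exp (-∫ β) ≤ 1`, `H' = α (e - 1) + e β (M - N) ≤
  -- 0`; the conclusion is `H b ≤ H a = M₀`.
  set H : ℝ → ℝ := fun s => N s * Real.exp (-∫ t in a..s, β t) - ∫ t in a..s, α t with hH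
  have hanti : AntitoneOn H (Icc a b) := by
    have hder : ∀ s ∈ Ioo a b, HasDerivAt H ((α s + β s * M s) * Real.exp (-∫ t in a..s, β t)
        + N s * (Real.exp (-∫ t in a..s, β t) * -β s) - α s) s := fun s hs =>
      (((hd1 s hs).const_add M₀).mul (hd3 s hs).neg.exp).sub (hd2 s hs)
    refine antitoneOn_of_deriv_nonpos (convex_Icc a b)
      (((continuousOn_const.add hc1).mul (Real.continuous_exp.comp_continuousOn hc3.neg)).sub hc2)
      ?_ ?_
    · rw [interior_Icc]
      exact fun s hs => (hder s hs).differentiableAt.differentiableWithinAt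
    · rw [interior_Icc]
      intro s hs
      rw [(hder s hs).deriv]
      have hs' := Ioo_subset_Icc_self hs
      have hint : 0 ≤ ∫ t in a..s, β t := intervalIntegral.integral_nonneg hs.1.le
        fun t ht => hβ0 t ⟨ht.1, ht.2.trans hs.2.le⟩
      have he : Real.exp (-∫ t in a..s, β t) ≤ 1 := Real.exp_le_one_iff.2 (by linarith)
      have he0 := Real.exp_pos (-∫ t in a..s, β t)
      have h1 : β s * (M s - N s) ≤ 0 :=
        mul_nonpos_of_nonneg_of_nonpos (hβ0 s hs') (sub_nonpos.2 (h s hs'))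
      nlinarith [mul_nonneg (hα0 s hs') (sub_nonneg.2 he), mul_nonneg (neg_nonneg.2 h1) he0.le]
  have hb := hanti (left_mem_Icc.2 hab) (right_mem_Icc.2 hab) hab
  simp only [hH, hN, intervalIntegral.integral_same, neg_zero, Real.exp_zero, mul_one, sub_zero,
    add_zero] at hb
  have hMb := h b (right_mem_Icc.2 hab)
  refine hMb.trans ?_
  rw [Real.exp_neg, ← div_eq_mul_inv, sub_le_iff_le_add, div_le_iff₀ (Real.exp_pos _)] at hb
  exact hb

/-- The growth of a solution of `p' = g`, `q' = -2 v q - g` along an arc on which `Re (v t)` is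
nondecreasing. -/
theorem arc_bound {Δ : Set ℂ} {v : ℂ} {p q g : ℂ → ℂ} {A B : ℂ → ℝ}
    (hp : ∀ z ∈ Δ, HasDerivAt p (g z) z)
    (hq : ∀ z ∈ Δ, HasDerivAt q (-2 * v * q z - g z) z)
    (hg : ContinuousOn g Δ) (hA : ContinuousOn A Δ) (hB : ContinuousOn B Δ)
    (hA0 : ∀ z, 0 ≤ A z) (hB0 : ∀ z, 0 ≤ B z)
    (hgb : ∀ z ∈ Δ, ‖g z‖ ≤ A z + B z * max ‖p z‖ ‖q z‖)
    {γ γ' : ℝ → ℂ} {a b : ℝ} (hab : a ≤ b) (hγ : ContinuousOn γ (Icc a b))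
    (hγ' : ContinuousOn γ' (Icc a b)) (hγd : ∀ t ∈ Ioo a b, HasDerivAt γ (γ' t) t)
    (hmem : ∀ t ∈ Icc a b, γ t ∈ Δ) (hmono : MonotoneOn (fun t => (v * γ t).re) (Icc a b)) :
    max ‖p (γ b)‖ ‖q (γ b)‖ ≤
      (max ‖p (γ a)‖ ‖q (γ a)‖ + ∫ t in a..b, A (γ t) * ‖γ' t‖) *
        Real.exp (∫ t in a..b, B (γ t) * ‖γ' t‖) := by
  have hpc : ContinuousOn p Δ := fun z hz => (hp z hz).continuousAt.continuousWithinAt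
  have hqc : ContinuousOn q Δ := fun z hz => (hq z hz).continuousAt.continuousWithinAt
  have hpγ : ContinuousOn (fun t => p (γ t)) (Icc a b) := hpc.comp hγ hmem
  have hqγ : ContinuousOn (fun t => q (γ t)) (Icc a b) := hqc.comp hγ hmem
  have hgγ : ContinuousOn (fun t => g (γ t)) (Icc a b) := hg.comp hγ hmem
  have hAγ : ContinuousOn (fun t => A (γ t) * ‖γ' t‖) (Icc a b) := (hA.comp hγ hmem).mul hγ'.norm
  have hBγ : ContinuousOn (fun t => B (γ t) * ‖γ' t‖) (Icc a b) := (hB.comp hγ hmem).mul hγ'.norm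
  have hMγ : ContinuousOn (fun t => max ‖p (γ t)‖ ‖q (γ t)‖) (Icc a b) := hpγ.norm.sup hqγ.norm
  refine gronwall_integral hab hAγ hBγ hMγ
    (fun t _ => mul_nonneg (hA0 _) (norm_nonneg _)) (fun t _ => mul_nonneg (hB0 _) (norm_nonneg _))
    fun s hs => ?_
  have hsub : Icc a s ⊆ Icc a b := Icc_subset_Icc_right hs.2
  have hIoo : Ioo a s ⊆ Ioo a b := Ioo_subset_Ioo_right hs.2
  set I : ℝ := ∫ t in a..s, ‖g (γ t)‖ * ‖γ' t‖ with hI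
  have hIint : IntervalIntegrable (fun t => ‖g (γ t)‖ * ‖γ' t‖) volume a s :=
    ((hgγ.norm.mul hγ'.norm).mono hsub).intervalIntegrable_of_Icc hs.1
  have hIle : I ≤ ∫ t in a..s, (A (γ t) * ‖γ' t‖ + B (γ t) * ‖γ' t‖ * max ‖p (γ t)‖ ‖q (γ t)‖) := by
    refine intervalIntegral.integral_mono_on hs.1 hIint
      (((hAγ.add (hBγ.mul hMγ)).mono hsub).intervalIntegrable_of_Icc hs.1) fun t ht => ?_
    have := mul_le_mul_of_nonneg_right (hgb _ (hmem t (hsub ht))) (norm_nonneg (γ' t))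
    linarith
  have hpI : ‖p (γ s)‖ ≤ ‖p (γ a)‖ + I := by
    have hftc := intervalIntegral.integral_eq_sub_of_hasDerivAt_of_le hs.1 (hpγ.mono hsub)
      (f' := fun t => g (γ t) * γ' t)
      (fun t ht => (hp _ (hmem t (hsub (Ioo_subset_Icc_self ht)))).comp t (hγd t (hIoo ht)))
      (((hgγ.mul hγ').mono hsub).intervalIntegrable_of_Icc hs.1)
    have hn : ‖∫ t in a..s, g (γ t) * γ' t‖ ≤ I := by
      refine (intervalIntegral.norm_integral_le_integral_norm hs.1).trans_eq ?_
      simp only [norm_mul, hI]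
    rw [hftc] at hn
    linarith [norm_sub_norm_le (p (γ s)) (p (γ a))]
  -- Integrating factor: `(e^{2vz} q)' = -e^{2vz} g`. The modulus of `e^{2vz}` is largest at the
  -- endpoint `γ s`, so dividing by it leaves no exponential factor.
  have hqI : ‖q (γ s)‖ ≤ ‖q (γ a)‖ + I := by
    have hexp : ContinuousOn (fun t => Complex.exp (2 * v * γ t)) (Icc a b) :=
      Complex.continuous_exp.comp_continuousOn (continuousOn_const.mul hγ)
    have hftc := intervalIntegral.integral_eq_sub_of_hasDerivAt_of_le hs.1
      ((hexp.mul hqγ).mono hsub)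
      (f' := fun t => -(Complex.exp (2 * v * γ t) * (g (γ t) * γ' t)))
      (fun t ht => by
        have h1 := hγd t (hIoo ht)
        have h2 := (hq _ (hmem t (hsub (Ioo_subset_Icc_self ht)))).comp t h1
        exact ((h1.const_mul (2 * v)).cexp.mul h2).congr_deriv (by
          simp only [Function.comp]; ring))
      (((hexp.mul (hgγ.mul hγ')).neg.mono hsub).intervalIntegrable_of_Icc hs.1)
    have hexple : ∀ t ∈ Icc a s, ‖Complex.exp (2 * v * γ t)‖ ≤ ‖Complex.exp (2 * v * γ s)‖ := by
      intro t ht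
      rw [Complex.norm_exp, Complex.norm_exp, Real.exp_le_exp]
      have h := hmono (hsub ht) hs ht.2
      simp only at h
      have e : ∀ w : ℂ, (2 * v * w).re = 2 * (v * w).re := fun w => by
        rw [mul_assoc]; simp
      rw [e, e]; linarith
    set K := ‖Complex.exp (2 * v * γ s)‖ with hK
    have hKpos : 0 < K := norm_pos_iff.2 (Complex.exp_ne_zero _)
    have hn : ‖∫ t in a..s, -(Complex.exp (2 * v * γ t) * (g (γ t) * γ' t))‖ ≤ K * I := by
      refine (intervalIntegral.norm_integral_le_integral_norm hs.1).trans ?_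
      rw [hI, ← intervalIntegral.integral_const_mul]
      refine intervalIntegral.integral_mono_on hs.1
        (((hexp.mul (hgγ.mul hγ')).neg.norm.mono hsub).intervalIntegrable_of_Icc hs.1)
        (hIint.const_mul K) fun t ht => ?_
      rw [norm_neg, norm_mul, norm_mul]
      gcongr
      exact hexple t ht
    rw [hftc] at hn
    have h3 := norm_sub_norm_le (Complex.exp (2 * v * γ s) * q (γ s))
      (Complex.exp (2 * v * γ a) * q (γ a))
    rw [norm_mul, norm_mul, ← hK] at h3
    have h4 := mul_le_mul_of_nonneg_right (hexple a (left_mem_Icc.2 hs.1)) (norm_nonneg (q (γ a)))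
    refine le_of_mul_le_mul_left ?_ hKpos
    simp only [Pi.mul_apply] at hn
    linarith
  refine max_le ?_ ?_
  · linarith [le_max_left ‖p (γ a)‖ ‖q (γ a)‖]
  · linarith [le_max_right ‖p (γ a)‖ ‖q (γ a)‖]

/-! ### The coefficients and the error equation -/

theorem F_zero (ψ : ℂ → ℂ) : F ψ 0 = fun _ => 0 := by unfold F; rfl

theorem F_one (ψ : ℂ → ℂ) : F ψ 1 = fun ξ => (1 / 2 : ℂ) * ψ ξ := by unfold F; rfl

theorem F_two (ψ : ℂ → ℂ) : F ψ 2 = fun ξ => -(1 / 4 : ℂ) * deriv ψ ξ := by unfold F; rfl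

theorem F_add_three (ψ : ℂ → ℂ) (r : ℕ) : F ψ (r + 3) = fun ξ =>
    -(1 / 2 : ℂ) * deriv (F ψ (r + 2)) ξ
      - (1 / 2 : ℂ) * ∑ i : Fin (r + 1), F ψ (i + 1) ξ * F ψ (r + 1 - i) ξ := by
  conv_lhs => unfold F

theorem differentiableOn_F {Δ : Set ℂ} (hΔ : IsOpen Δ) {ψ : ℂ → ℂ} (hψ : DifferentiableOn ℂ ψ Δ)
    (s : ℕ) : DifferentiableOn ℂ (F ψ s) Δ := by
  induction s using Nat.strong_induction_on with
  | _ s ih =>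
    match s with
    | 0 => rw [F_zero]; exact differentiableOn_const _
    | 1 => rw [F_one]; exact hψ.const_mul _
    | 2 => rw [F_two]; exact (hψ.deriv hΔ).const_mul _
    | r + 3 =>
      rw [F_add_three]
      refine (((ih (r + 2) (by omega)).deriv hΔ).const_mul _).sub (DifferentiableOn.const_mul ?_ _)
      refine DifferentiableOn.fun_sum fun i _ => ?_
      exact (ih _ (by omega)).mul (ih _ (by omega))

/-- This is the coefficient of `v⁻ˢ` in the Riccati equation `y' + 2vy + y² = ψ` for `y = ∑ F_s
v⁻ˢ`; the value `F ψ 0 = 0` merges the three defining clauses into one. -/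
theorem F_recursion (ψ : ℂ → ℂ) (s : ℕ) (ξ : ℂ) :
    2 * F ψ (s + 1) ξ + deriv (F ψ s) ξ
      + ∑ k ∈ Finset.range (s + 1), F ψ k ξ * F ψ (s - k) ξ = if s = 0 then ψ ξ else 0 := by
  match s with
  | 0 => simp [F_zero, F_one]
  | 1 => simp [F_zero, F_one, F_two, Finset.sum_range_succ, deriv_const_mul_field]; ring
  | r + 2 =>
    rw [F_add_three, Finset.sum_range_succ, Finset.sum_range_succ', ← Fin.sum_univ_eq_sum_range
      (fun k => F ψ (k + 1) ξ * F ψ (r + 2 - (k + 1)) ξ)]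
    simp only [F_zero, Nat.sub_self, Nat.reduceSubDiff]
    simp
    ring

/-- The pairs `(i, j)` are split by `i + j ≤ m` or `i + j > m`. The first part matches the
recursion; the second, with `s = i + j - m`, produces the sums `G`. -/
theorem sq_sum_range {R : Type*} [CommRing R] (f : ℕ → R) (x : R) (m : ℕ) :
    (∑ s ∈ Finset.range (m + 1), f s * x ^ s) ^ 2 =
      ∑ s ∈ Finset.range (m + 1), (∑ k ∈ Finset.range (s + 1), f k * f (s - k)) * x ^ s +
      x ^ m * ∑ s ∈ Finset.Icc 1 m, (∑ k ∈ Finset.Icc s m, f k * f (s + m - k)) * x ^ s := by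
  have h1 := Finset.sum_range_diag_flip (m + 1) fun i j => (f i * x ^ i) * (f j * x ^ j)
  have h2 : ∑ i ∈ Finset.range (m + 1), ∑ j ∈ Finset.Ico (m + 1 - i) (m + 1),
      (f i * x ^ i) * (f j * x ^ j) =
      ∑ s ∈ Finset.Icc 1 m, ∑ k ∈ Finset.Icc s m, (f k * x ^ k) * (f (s + m - k) * x ^ (s + m - k)) := by
    rw [Finset.sum_comm' (s := Finset.Icc 1 m) (t' := Finset.range (m + 1))
      (s' := fun k => Finset.Icc 1 k)]
    · refine Finset.sum_congr rfl fun i hi => ?_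
      rw [Finset.mem_range] at hi
      refine Finset.sum_nbij' (fun j => j + i - m) (fun s => s + m - i) ?_ ?_ ?_ ?_ ?_
      · intro j hj; rw [Finset.mem_Ico] at hj; rw [Finset.mem_Icc]; omega
      · intro j hj; rw [Finset.mem_Icc] at hj; rw [Finset.mem_Ico]; omega
      · intro j hj; rw [Finset.mem_Ico] at hj; omega
      · intro j hj; rw [Finset.mem_Icc] at hj; omega
      · intro j hj
        rw [Finset.mem_Ico] at hj
        rw [show j + i - m + m - i = j by omega]
    · intro s k
      simp only [Finset.mem_Icc, Finset.mem_range]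
      omega
  rw [sq, Finset.sum_mul_sum]
  have h3 : ∀ i ∈ Finset.range (m + 1), ∑ j ∈ Finset.range (m + 1), (f i * x ^ i) * (f j * x ^ j) =
      ∑ j ∈ Finset.range (m + 1 - i), (f i * x ^ i) * (f j * x ^ j) +
      ∑ j ∈ Finset.Ico (m + 1 - i) (m + 1), (f i * x ^ i) * (f j * x ^ j) := fun i _ =>
    (Finset.sum_range_add_sum_Ico _ (by omega)).symm
  rw [Finset.sum_congr rfl h3, Finset.sum_add_distrib, ← h1, h2, Finset.mul_sum]
  congr 1
  · refine Finset.sum_congr rfl fun s _ => ?_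
    rw [Finset.sum_mul]
    refine Finset.sum_congr rfl fun k hk => ?_
    rw [Finset.mem_range] at hk
    calc _ = f k * f (s - k) * x ^ (k + (s - k)) := by ring
      _ = _ := by rw [show k + (s - k) = s by omega]
  · refine Finset.sum_congr rfl fun s _ => ?_
    rw [Finset.sum_mul, Finset.mul_sum]
    refine Finset.sum_congr rfl fun k hk => ?_
    rw [Finset.mem_Icc] at hk
    calc _ = f k * f (s + m - k) * x ^ (k + (s + m - k)) := by ring
      _ = f k * f (s + m - k) * x ^ (m + s) := by rw [show k + (s + m - k) = m + s by omega]
      _ = _ := by ring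

theorem differentiableOn_T {Δ : Set ℂ} (hΔ : IsOpen Δ) {ψ : ℂ → ℂ} (hψ : DifferentiableOn ℂ ψ Δ)
    (n : ℕ) (v : ℂ) : DifferentiableOn ℂ (T ψ n v) Δ :=
  DifferentiableOn.fun_sum fun _ _ => (differentiableOn_F hΔ hψ _).div_const _

theorem differentiableOn_chi {Δ : Set ℂ} (hΔ : IsOpen Δ) {ψ : ℂ → ℂ} (hψ : DifferentiableOn ℂ ψ Δ)
    (n : ℕ) (v : ℂ) : DifferentiableOn ℂ (chi ψ n v) Δ :=
  ((differentiableOn_F hΔ hψ n).const_mul _).sub <| DifferentiableOn.fun_sum fun _ _ =>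
    DifferentiableOn.div_const (DifferentiableOn.fun_sum fun k _ =>
      (differentiableOn_F hΔ hψ k).mul (differentiableOn_F hΔ hψ _)) _

theorem T_div_eq (ψ : ℂ → ℂ) (m : ℕ) (v ξ : ℂ) :
    T ψ (m + 1) v ξ / v = ∑ s ∈ Finset.range (m + 1), F ψ s ξ * v⁻¹ ^ s := by
  rw [T, Finset.sum_div, Finset.sum_range_succ']
  simp only [F_zero, zero_mul, add_zero, Nat.add_sub_cancel]
  refine Finset.sum_congr rfl fun s _ => ?_
  rw [div_eq_mul_inv, div_eq_mul_inv, pow_succ, inv_pow]; ring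

/-- The residual of the truncated formal solution `exp (v ξ + S)`. -/
theorem residual_eq {Δ : Set ℂ} (hΔ : IsOpen Δ) {ψ : ℂ → ℂ} (hψ : DifferentiableOn ℂ ψ Δ)
    {n : ℕ} (hn : 1 ≤ n) (v : ℂ) {ξ : ℂ} (hξ : ξ ∈ Δ) :
    2 * T ψ n v ξ + deriv (T ψ n v) ξ / v + (T ψ n v ξ / v) ^ 2 - ψ ξ =
      -(chi ψ n v ξ / v ^ (n - 1)) := by
  obtain ⟨m, rfl⟩ := Nat.exists_eq_add_of_le' hn
  have hd : deriv (T ψ (m + 1) v) ξ / v =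
      ∑ s ∈ Finset.range (m + 1), deriv (F ψ s) ξ * v⁻¹ ^ s := by
    have hF : ∀ s, HasDerivAt (F ψ s) (deriv (F ψ s) ξ) ξ := fun s =>
      ((differentiableOn_F hΔ hψ s).differentiableAt (hΔ.mem_nhds hξ)).hasDerivAt
    have h1 := (((differentiableOn_T hΔ hψ (m + 1) v).differentiableAt
      (hΔ.mem_nhds hξ)).hasDerivAt).div_const v
    have h2 : HasDerivAt (fun ξ => ∑ s ∈ Finset.range (m + 1), F ψ s ξ * v⁻¹ ^ s)
        (∑ s ∈ Finset.range (m + 1), deriv (F ψ s) ξ * v⁻¹ ^ s) ξ :=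
      HasDerivAt.fun_sum fun s _ => (hF s).mul_const _
    rw [← funext (T_div_eq ψ m v)] at h2
    exact h1.unique h2
  -- `T` stops one term short of the recursion's range; the missing term is the `2 F_n` in `χ_n`.
  have h2T : 2 * T ψ (m + 1) v ξ = ∑ s ∈ Finset.range (m + 1), 2 * F ψ (s + 1) ξ * v⁻¹ ^ s
      - 2 * F ψ (m + 1) ξ * v⁻¹ ^ m := by
    rw [Finset.sum_range_succ, add_sub_cancel_right, T, Finset.mul_sum]
    refine Finset.sum_congr rfl fun s _ => ?_
    rw [div_eq_mul_inv, inv_pow]; ring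
  have hrec : ∑ s ∈ Finset.range (m + 1), 2 * F ψ (s + 1) ξ * v⁻¹ ^ s +
      ∑ s ∈ Finset.range (m + 1), deriv (F ψ s) ξ * v⁻¹ ^ s +
      ∑ s ∈ Finset.range (m + 1), (∑ k ∈ Finset.range (s + 1), F ψ k ξ * F ψ (s - k) ξ) * v⁻¹ ^ s
      = ψ ξ := by
    rw [← Finset.sum_add_distrib, ← Finset.sum_add_distrib]
    have : ∀ s ∈ Finset.range (m + 1), 2 * F ψ (s + 1) ξ * v⁻¹ ^ s + deriv (F ψ s) ξ * v⁻¹ ^ s +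
        (∑ k ∈ Finset.range (s + 1), F ψ k ξ * F ψ (s - k) ξ) * v⁻¹ ^ s
        = if s = 0 then ψ ξ else 0 := by
      intro s _
      rw [← add_mul, ← add_mul, F_recursion]
      split_ifs with h <;> simp [h]
    rw [Finset.sum_congr rfl this]
    simp
  have hχ : chi ψ (m + 1) v ξ / v ^ (m + 1 - 1) = 2 * F ψ (m + 1) ξ * v⁻¹ ^ m - v⁻¹ ^ m *
      ∑ s ∈ Finset.Icc 1 m, (∑ k ∈ Finset.Icc s m, F ψ k ξ * F ψ (s + m - k) ξ) * v⁻¹ ^ s := by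
    rw [chi, Nat.add_sub_cancel, div_eq_mul_inv, ← inv_pow, sub_mul, mul_comm (v⁻¹ ^ m)]
    congr 2
    refine Finset.sum_congr rfl fun s _ => ?_
    rw [div_eq_mul_inv, inv_pow, G]
    congr 1
    refine Finset.sum_congr (by rw [Nat.add_sub_cancel]) fun k _ => ?_
    rw [show s + (m + 1) - k - 1 = s + m - k by omega]
  rw [hχ, T_div_eq, sq_sum_range, hd, h2T]
  linear_combination hrec

theorem hasDerivAt_S {ψ : ℂ → ℂ} {E : ℕ → ℂ → ℂ} {ξ : ℂ}
    (hE : ∀ s : ℕ, 1 ≤ s → HasDerivAt (E s) (F ψ s ξ) ξ) {n : ℕ} (hn : 1 ≤ n) (v : ℂ) :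
    HasDerivAt (S E n v) (T ψ n v ξ / v) ξ := by
  obtain ⟨m, rfl⟩ := Nat.exists_eq_add_of_le' hn
  have h : HasDerivAt (S E (m + 1) v) (∑ s ∈ Finset.Icc 1 (m + 1 - 1), F ψ s ξ / v ^ s) ξ :=
    HasDerivAt.fun_sum fun s hs => (hE s (Finset.mem_Icc.1 hs).1).div_const _
  refine h.congr_deriv ?_
  rw [T_div_eq, Nat.add_sub_cancel, Finset.sum_range_succ', F_zero, zero_mul, add_zero,
    ← Finset.Ico_succ_right_eq_Icc, Finset.sum_Ico_eq_sum_range]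
  refine Finset.sum_congr (by simp) fun s _ => ?_
  rw [add_comm 1 s, div_eq_mul_inv, inv_pow]

/-- The error term `ε` belonging to a solution `w`. -/
noncomputable def err (E : ℕ → ℂ → ℂ) (n : ℕ) (v : ℂ) (w : ℂ → ℂ) (ξ : ℂ) : ℂ :=
  Complex.exp (-S E n v ξ) * w ξ - Complex.exp (v * ξ)

/-- The derivative of the error term belonging to a solution `w` with derivative `w'`. -/
noncomputable def errDeriv (ψ : ℂ → ℂ) (E : ℕ → ℂ → ℂ) (n : ℕ) (v : ℂ) (w w' : ℂ → ℂ) (ξ : ℂ) : ℂ :=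
  Complex.exp (-S E n v ξ) * (w' ξ - T ψ n v ξ / v * w ξ) - v * Complex.exp (v * ξ)

/-- The larger of `|e^{-vξ} (ε + ε'/v)|` and `|e^{-vξ} (ε - ε'/v)|`. -/
noncomputable def errSize (ψ : ℂ → ℂ) (E : ℕ → ℂ → ℂ) (n : ℕ) (v : ℂ) (w w' : ℂ → ℂ) (ξ : ℂ) : ℝ :=
  max ‖Complex.exp (-(v * ξ)) * (err E n v w ξ + errDeriv ψ E n v w w' ξ / v)‖
    ‖Complex.exp (-(v * ξ)) * (err E n v w ξ - errDeriv ψ E n v w w' ξ / v)‖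

/-- The data common to the estimates. -/
structure Setting (Δ : Set ℂ) (ψ : ℂ → ℂ) (E : ℕ → ℂ → ℂ) (n : ℕ) (v : ℂ) : Prop where
  isOpen : IsOpen Δ
  diff : DifferentiableOn ℂ ψ Δ
  antideriv : ∀ s : ℕ, 1 ≤ s → ∀ ξ ∈ Δ, HasDerivAt (E s) (F ψ s ξ) ξ
  one_le : 1 ≤ n
  ne_zero : v ≠ 0

section
variable {Δ : Set ℂ} {ψ : ℂ → ℂ} {E : ℕ → ℂ → ℂ} {n : ℕ} {v : ℂ}

theorem norm_err_le (w w' : ℂ → ℂ) (ξ : ℂ) :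
    max ‖err E n v w ξ‖ ‖errDeriv ψ E n v w w' ξ / v‖ ≤
      ‖Complex.exp (v * ξ)‖ * errSize ψ E n v w w' ξ := by
  have he : Complex.exp (v * ξ) * Complex.exp (-(v * ξ)) = 1 := by
    rw [← Complex.exp_add]; simp
  set e := Complex.exp (v * ξ)
  set f := Complex.exp (-(v * ξ)) with hf
  set a := err E n v w ξ with ha
  set b := errDeriv ψ E n v w w' ξ / v with hb
  have h1 : ‖f * (a + b)‖ ≤ errSize ψ E n v w w' ξ := le_max_left _ _
  have h2 : ‖f * (a - b)‖ ≤ errSize ψ E n v w w' ξ := le_max_right _ _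
  have ha' : a = e * ((f * (a + b) + f * (a - b)) / 2) := by linear_combination -a * he
  have hb' : b = e * ((f * (a + b) - f * (a - b)) / 2) := by linear_combination -b * he
  refine max_le ?_ ?_
  · rw [ha', norm_mul, norm_div]
    gcongr
    rw [Complex.norm_ofNat, div_le_iff₀ (by norm_num)]
    linarith [norm_add_le (f * (a + b)) (f * (a - b))]
  · rw [hb', norm_mul, norm_div]
    gcongr
    rw [Complex.norm_ofNat, div_le_iff₀ (by norm_num)]
    linarith [norm_sub_le (f * (a + b)) (f * (a - b))]

theorem Setting.hasDerivAt_err (h : Setting Δ ψ E n v) {w w' : ℂ → ℂ}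
    (hw : SolvesOn Δ (fun z => v ^ 2 + ψ z) w w') {ξ : ℂ} (hξ : ξ ∈ Δ) :
    HasDerivAt (err E n v w) (errDeriv ψ E n v w w' ξ) ξ := by
  have hS := hasDerivAt_S (fun s hs => h.antideriv s hs ξ hξ) h.one_le v
  have := (hS.neg.cexp.mul (hw ξ hξ).1).sub (((hasDerivAt_id ξ).const_mul v).cexp)
  refine this.congr_deriv ?_
  simp only [errDeriv, id, Pi.neg_apply]
  ring

/-- By `residual_eq`, `y = e^{vξ} + ε` satisfies `y'' = (v² + χ / v ^ (n - 1)) y - 2 (T / v) (y' - v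
y)`. Since `y' - v y` vanishes for `e^{vξ}`, `T` contributes no forcing, which is why it enters the
final bound only in the exponential. -/
theorem Setting.hasDerivAt_errDeriv (h : Setting Δ ψ E n v) {w w' : ℂ → ℂ}
    (hw : SolvesOn Δ (fun z => v ^ 2 + ψ z) w w') {ξ : ℂ} (hξ : ξ ∈ Δ) :
    HasDerivAt (errDeriv ψ E n v w w') (v ^ 2 * err E n v w ξ +
      chi ψ n v ξ / v ^ (n - 1) * (Complex.exp (v * ξ) + err E n v w ξ) -
      2 * (T ψ n v ξ / v) * (errDeriv ψ E n v w w' ξ - v * err E n v w ξ)) ξ := by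
  have hS := hasDerivAt_S (fun s hs => h.antideriv s hs ξ hξ) h.one_le v
  have hT := ((differentiableOn_T h.isOpen h.diff n v).differentiableAt
      (h.isOpen.mem_nhds hξ)).hasDerivAt
  have hv := h.ne_zero
  have hR := residual_eq h.isOpen h.diff h.one_le v hξ
  have := (hS.neg.cexp.mul ((hw ξ hξ).2.sub ((hT.div_const v).mul (hw ξ hξ).1))).sub
    ((((hasDerivAt_id ξ).const_mul v).cexp).const_mul v)
  refine this.congr_deriv ?_
  have hTv : T ψ n v ξ = T ψ n v ξ / v * v := by field_simp
  simp only [errDeriv, err, id, Pi.neg_apply, Pi.sub_apply, Pi.mul_apply]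
  generalize deriv (T ψ n v) ξ / v = T' at *
  generalize T ψ n v ξ / v = t at *
  rw [hTv] at hR
  generalize chi ψ n v ξ / v ^ (n - 1) = c at *
  linear_combination (-Complex.exp (-S E n v ξ) * w ξ) * hR

/-! ### Estimates of the error term along progressive paths -/

theorem Setting.errSize_arc (h : Setting Δ ψ E n v) {w w' : ℂ → ℂ}
    (hw : SolvesOn Δ (fun z => v ^ 2 + ψ z) w w') {γ γ' : ℝ → ℂ} {a b : ℝ} (hab : a ≤ b)
    (hγ : ContinuousOn γ (Icc a b)) (hγ' : ContinuousOn γ' (Icc a b))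
    (hγd : ∀ t ∈ Ioo a b, HasDerivAt γ (γ' t) t) (hmem : ∀ t ∈ Icc a b, γ t ∈ Δ)
    (hmono : MonotoneOn (fun t => (v * γ t).re) (Icc a b)) :
    errSize ψ E n v w w' (γ b) ≤
      (errSize ψ E n v w w' (γ a) + 1 / ‖v‖ ^ n * ∫ t in a..b, ‖chi ψ n v (γ t)‖ * ‖γ' t‖) *
        Real.exp (4 / ‖v‖ * (∫ t in a..b, ‖T ψ n v (γ t)‖ * ‖γ' t‖) +
          1 / ‖v‖ ^ n * ∫ t in a..b, ‖chi ψ n v (γ t)‖ * ‖γ' t‖) := by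
  have hv := h.ne_zero
  have hχc := (differentiableOn_chi h.isOpen h.diff n v).continuousOn
  have hTc := (differentiableOn_T h.isOpen h.diff n v).continuousOn
  set ε := err E n v w with hε
  set δ := errDeriv ψ E n v w w' with hδ
  have hεd : ∀ z ∈ Δ, HasDerivAt ε (δ z) z := fun z hz => h.hasDerivAt_err hw hz
  have hδd := fun z hz => h.hasDerivAt_errDeriv hw (ξ := z) hz
  set p : ℂ → ℂ := fun ξ => Complex.exp (-(v * ξ)) * (ε ξ + δ ξ / v) with hp
  set q : ℂ → ℂ := fun ξ => Complex.exp (-(v * ξ)) * (ε ξ - δ ξ / v) with hq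
  -- In terms of `p` and `q`, `e^{-vξ} ε = (p + q) / 2` and `e^{-vξ} (ε' - v ε) = -v q`.
  set g : ℂ → ℂ := fun ξ => chi ψ n v ξ / v ^ n * (1 + (p ξ + q ξ) / 2)
    + 2 * (T ψ n v ξ / v) * q ξ with hg
  have hexpd : ∀ z, HasDerivAt (fun ξ => Complex.exp (-(v * ξ))) (Complex.exp (-(v * z)) * -v) z :=
    fun z => (((hasDerivAt_id z).const_mul v).neg.cexp).congr_deriv (by simp)
  have hvn : v ^ n = v ^ (n - 1) * v := by
    rw [← pow_succ, Nat.sub_add_cancel h.one_le]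
  have he : ∀ z, Complex.exp (v * z) * Complex.exp (-(v * z)) = 1 := fun z => by
    rw [← Complex.exp_add]; simp
  have hvn1 : v ^ (n - 1) ≠ 0 := pow_ne_zero _ hv
  have hpd : ∀ z ∈ Δ, HasDerivAt p (g z) z := fun z hz => by
    refine ((hexpd z).mul ((hεd z hz).add ((hδd z hz).div_const v))).congr_deriv ?_
    simp only [hg, hp, hq, Pi.add_apply, hvn, ← hε, ← hδ]
    field_simp
    linear_combination (2 * v * chi ψ n v z) * he z
  have hqd : ∀ z ∈ Δ, HasDerivAt q (-2 * v * q z - g z) z := fun z hz => by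
    refine ((hexpd z).mul ((hεd z hz).sub ((hδd z hz).div_const v))).congr_deriv ?_
    simp only [hg, hp, hq, Pi.sub_apply, hvn, ← hε, ← hδ]
    field_simp
    linear_combination -(2 * v * chi ψ n v z) * he z
  have hpc : ContinuousOn p Δ := fun z hz => (hpd z hz).continuousAt.continuousWithinAt
  have hqc : ContinuousOn q Δ := fun z hz => (hqd z hz).continuousAt.continuousWithinAt
  have hgc : ContinuousOn g Δ := by fun_prop (disch := simp [hv])
  have hmain := arc_bound (A := fun z => 1 / ‖v‖ ^ n * ‖chi ψ n v z‖)
    (B := fun z => 4 / ‖v‖ * ‖T ψ n v z‖ + 1 / ‖v‖ ^ n * ‖chi ψ n v z‖) hpd hqd hgc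
    (by fun_prop) (by fun_prop) (fun z => by positivity) (fun z => by positivity)
    (fun z hz => by
      have h1 : ‖1 + (p z + q z) / 2‖ ≤ 1 + max ‖p z‖ ‖q z‖ := by
        refine (norm_add_le _ _).trans ?_
        rw [norm_one, norm_div, Complex.norm_ofNat]
        have := norm_add_le (p z) (q z)
        have h1 := le_max_left ‖p z‖ ‖q z‖
        have h2 := le_max_right ‖p z‖ ‖q z‖
        linarith
      calc ‖g z‖ ≤ ‖chi ψ n v z / v ^ n * (1 + (p z + q z) / 2)‖ + ‖2 * (T ψ n v z / v) * q z‖ :=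
            norm_add_le _ _
        _ = ‖chi ψ n v z‖ / ‖v‖ ^ n * ‖1 + (p z + q z) / 2‖ + 2 * (‖T ψ n v z‖ / ‖v‖) * ‖q z‖ := by
            simp only [norm_mul, norm_div, norm_pow, Complex.norm_ofNat]
        -- The argument gives the factor `2` for `T`; it is relaxed to the `4` of the stated bound.
        _ ≤ ‖chi ψ n v z‖ / ‖v‖ ^ n * (1 + max ‖p z‖ ‖q z‖) +
              4 * (‖T ψ n v z‖ / ‖v‖) * max ‖p z‖ ‖q z‖ := by
            gcongr
            · norm_num
            · exact le_max_right _ _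
        _ = _ := by ring)
    hab hγ hγ' hγd hmem hmono
  have hχi : IntervalIntegrable (fun t => ‖chi ψ n v (γ t)‖ * ‖γ' t‖) volume a b :=
    ((hχc.comp hγ hmem).norm.mul hγ'.norm).intervalIntegrable_of_Icc hab
  have hTi : IntervalIntegrable (fun t => ‖T ψ n v (γ t)‖ * ‖γ' t‖) volume a b :=
    ((hTc.comp hγ hmem).norm.mul hγ'.norm).intervalIntegrable_of_Icc hab
  simp only [add_mul, mul_assoc] at hmain
  rw [intervalIntegral.integral_add (hTi.const_mul _) (hχi.const_mul _),
    intervalIntegral.integral_const_mul, intervalIntegral.integral_const_mul, ← add_mul] at hmain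
  exact hmain

theorem R2Arc.absIntegral_nonneg (γ : R2Arc) (g : ℂ → ℂ) : 0 ≤ γ.absIntegral g :=
  integral_nonneg fun _ => by positivity

theorem R2Arc.absIntegral_eq (γ : R2Arc) (g : ℂ → ℂ) :
    γ.absIntegral g = ∫ t in (0 : ℝ)..1, ‖g (γ.toFun t)‖ * ‖derivWithin γ.toFun (Icc 0 1) t‖ := by
  rw [R2Arc.absIntegral, integral_Icc_eq_integral_Ioc, intervalIntegral.integral_of_le zero_le_one]

/-- Bounds on consecutive arcs compose because the first exponential is at least `1` and may be
attached to the second forcing term. -/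
theorem add_mul_exp_trans {m₀ m₁ m₂ x y x' y' a b : ℝ} (hx : 0 ≤ x) (hx' : 0 ≤ x') (hy : 0 ≤ y)
    (ha : 0 ≤ a) (hb : 0 ≤ b)
    (h1 : m₁ ≤ (m₀ + a * x) * Real.exp (b * y + a * x))
    (h2 : m₂ ≤ (m₁ + a * x') * Real.exp (b * y' + a * x')) :
    m₂ ≤ (m₀ + a * (x + x')) * Real.exp (b * (y + y') + a * (x + x')) := by
  have he : 1 ≤ Real.exp (b * y + a * x) := Real.one_le_exp (by positivity)
  calc m₂ ≤ _ := h2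
    _ ≤ ((m₀ + a * x) * Real.exp (b * y + a * x) + a * x' * Real.exp (b * y + a * x)) *
        Real.exp (b * y' + a * x') := by
      exact mul_le_mul_of_nonneg_right
        (add_le_add h1 (le_mul_of_one_le_right (mul_nonneg ha hx') he)) (Real.exp_pos _).le
    _ = (m₀ + a * (x + x')) * (Real.exp (b * y + a * x) * Real.exp (b * y' + a * x')) := by ring
    _ = _ := by rw [← Real.exp_add]; ring_nf

/-- The relation `hu` covers both signs, `j = 1, v = u` and `j = 2, v = -u`; it turns nonincreasing
`Re ((-1)^j u t)` into nondecreasing `Re (v t)`. -/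
theorem Setting.errSize_chain (h : Setting Δ ψ E n v) {w w' : ℂ → ℂ}
    (hw : SolvesOn Δ (fun z => v ^ 2 + ψ z) w w') {j : ℕ} {u : ℂ} (hu : (-1 : ℂ) ^ j * u = -v)
    (l : List R2Arc) (p q : ℂ) (hl : IsProgressiveChain Δ j u p l q) :
    errSize ψ E n v w w' q ≤ (errSize ψ E n v w w' p +
      1 / ‖v‖ ^ n * (l.map fun γ => γ.absIntegral (chi ψ n v)).sum) *
        Real.exp (4 / ‖v‖ * (l.map fun γ => γ.absIntegral (T ψ n v)).sum +
          1 / ‖v‖ ^ n * (l.map fun γ => γ.absIntegral (chi ψ n v)).sum) := by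
  induction l generalizing p with
  | nil =>
    have : p = q := hl
    simp [this]
  | cons γ l ih =>
    obtain ⟨h0, hm, hanti, hl⟩ := hl
    have h1 := h.errSize_arc hw zero_le_one γ.contDiffOn.continuousOn
      (γ.contDiffOn.continuousOn_derivWithin (uniqueDiffOn_Icc zero_lt_one) (by norm_num))
      (fun t ht => ((γ.contDiffOn.differentiableOn (by norm_num) t
        (Ioo_subset_Icc_self ht)).hasDerivWithinAt).hasDerivAt (Icc_mem_nhds ht.1 ht.2))
      hm (fun s hs t ht hst => by
        have := hanti hs ht hst
        simp only [hu, neg_mul, Complex.neg_re, neg_le_neg_iff] at this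
        exact this)
    rw [← R2Arc.absIntegral_eq, ← R2Arc.absIntegral_eq, h0] at h1
    rw [List.map_cons, List.map_cons, List.sum_cons, List.sum_cons]
    refine add_mul_exp_trans (γ.absIntegral_nonneg _) (List.sum_nonneg ?_)
      (γ.absIntegral_nonneg _) (by positivity) (by positivity) h1 (ih _ hl)
    simp only [List.mem_map, forall_exists_index, and_imp]
    rintro _ γ' - rfl
    exact γ'.absIntegral_nonneg _

theorem InfiniteR2Arc.integrand_nonneg (ℒ : InfiniteR2Arc) (g : ℂ → ℂ) (τ : ℝ) :
    0 ≤ ℒ.integrand g τ := by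
  unfold InfiniteR2Arc.integrand; positivity

/-- Starting from zero error at the finite point `ℒ K`, the arc is run back to `ℒ τ`. Replacing the
integrals over `[τ, K]` by those over the whole tail makes the bound independent of `K`. -/
theorem Setting.errSize_tail (h : Setting Δ ψ E n v) {w w' : ℂ → ℂ}
    (hw : SolvesOn Δ (fun z => v ^ 2 + ψ z) w w') {j : ℕ} {u : ℂ} (hu : (-1 : ℂ) ^ j * u = -v)
    (ℒ : InfiniteR2Arc) {τ K : ℝ} (hτ : 0 ≤ τ) (hK : τ ≤ K) (hmem : ∀ t ∈ Ici τ, ℒ.toFun t ∈ Δ)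
    (hmono : MonotoneOn (fun t => ((-1 : ℂ) ^ j * u * ℒ.toFun t).re) (Ici τ))
    (hχ : IntegrableOn (ℒ.integrand (chi ψ n v)) (Ici 0))
    (hT : IntegrableOn (ℒ.integrand (T ψ n v)) (Ici 0))
    (h0 : errSize ψ E n v w w' (ℒ.toFun K) = 0) :
    errSize ψ E n v w w' (ℒ.toFun τ) ≤
      (0 + 1 / ‖v‖ ^ n * ∫ t in Ici τ, ℒ.integrand (chi ψ n v) t) *
        Real.exp (4 / ‖v‖ * (∫ t in Ici τ, ℒ.integrand (T ψ n v) t) +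
          1 / ‖v‖ ^ n * ∫ t in Ici τ, ℒ.integrand (chi ψ n v) t) := by
  -- Reverses the direction of travel on `[τ, K]`.
  set r : ℝ → ℝ := fun t => τ + K - t with hr
  have hrIcc : ∀ t ∈ Icc τ K, r t ∈ Ici τ := fun t ht => by
    simp only [hr, mem_Ici]; linarith [ht.2]
  have hrIci : ∀ t ∈ Icc τ K, r t ∈ Ici (0 : ℝ) := fun t ht => hτ.trans (hrIcc t ht)
  have hrc : ContinuousOn r (Icc τ K) := by fun_prop
  have hd : ContinuousOn (derivWithin ℒ.toFun (Ici 0)) (Ici 0) :=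
    ℒ.contDiffOn.continuousOn_derivWithin (uniqueDiffOn_Ici 0) (by norm_num)
  have h1 := h.errSize_arc hw (γ := fun t => ℒ.toFun (r t))
    (γ' := fun t => -derivWithin ℒ.toFun (Ici 0) (r t)) hK
    (ℒ.contDiffOn.continuousOn.comp hrc hrIci) ((hd.comp hrc hrIci).neg)
    (fun t ht => by
      have hpos : 0 < r t := by simp only [hr]; linarith [ht.2]
      have hℒ := ((ℒ.contDiffOn.differentiableOn (by norm_num) (r t)
        hpos.le).hasDerivWithinAt).hasDerivAt (Ici_mem_nhds hpos)
      have hr' : HasDerivAt r (-1) t := (hasDerivAt_id t).const_sub (τ + K)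
      exact (hℒ.scomp t hr').congr_deriv (by simp))
    (fun t ht => hmem _ (hrIcc t ht))
    (fun s hs t ht hst => by
      have := hmono (hrIcc t ht) (hrIcc s hs) (by simp only [hr]; linarith)
      simp only [hu, neg_mul, Complex.neg_re, neg_le_neg_iff] at this
      exact this)
  have hint : ∀ g : ℂ → ℂ, IntegrableOn (ℒ.integrand g) (Ici 0) →
      0 ≤ ∫ t in τ..K, ‖g (ℒ.toFun (r t))‖ * ‖-derivWithin ℒ.toFun (Ici 0) (r t)‖ ∧
      ∫ t in τ..K, ‖g (ℒ.toFun (r t))‖ * ‖-derivWithin ℒ.toFun (Ici 0) (r t)‖ ≤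
        ∫ t in Ici τ, ℒ.integrand g t := by
    intro g hg
    refine ⟨intervalIntegral.integral_nonneg hK fun _ _ => by positivity, ?_⟩
    have := intervalIntegral.integral_comp_sub_left (a := τ) (b := K) (ℒ.integrand g) (τ + K)
    simp only [InfiniteR2Arc.integrand] at this
    simp only [norm_neg, hr, this]
    rw [add_sub_cancel_right, add_sub_cancel_left, intervalIntegral.integral_of_le hK]
    exact setIntegral_mono_set (hg.mono_set (Ici_subset_Ici.2 hτ))
      (Eventually.of_forall fun t => ℒ.integrand_nonneg g t)
      (Eventually.of_forall fun t ht => ht.1.le)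
  obtain ⟨hχ0, hχ1⟩ := hint _ hχ
  obtain ⟨hT0, hT1⟩ := hint _ hT
  simp only [hr, add_sub_cancel_right, add_sub_cancel_left, h0] at h1
  refine h1.trans ?_
  simp only [hr] at hχ0 hχ1 hT0 hT1
  have hn : 0 ≤ 0 + 1 / ‖v‖ ^ n * ∫ t in Ici τ, ℒ.integrand (chi ψ n v) t :=
    add_nonneg le_rfl (mul_nonneg (by positivity) (hχ0.trans hχ1))
  gcongr

/-! ### Existence of the solutions -/

/-- Cramer's rule with constant Wronskians. -/
theorem SolvesOn.eq_combo {U : Set ℂ} (hU : IsOpen U) (hc : IsPreconnected U)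
    {Q w w' a a' b b' : ℂ → ℂ} (hw : SolvesOn U Q w w') (ha : SolvesOn U Q a a')
    (hb : SolvesOn U Q b b') {p : ℂ} (hp : p ∈ U) (ha0 : a p = 1) (ha1 : a' p = 0)
    (hb0 : b p = 0) (hb1 : b' p = 1) {z : ℂ} (hz : z ∈ U) :
    w z = w p * a z + w' p * b z ∧ w' z = w p * a' z + w' p * b' z := by
  have h1 := ha.wronskian_eq hU hc hb hz hp
  have h2 := hw.wronskian_eq hU hc ha hz hp
  have h3 := hw.wronskian_eq hU hc hb hz hp
  simp only [ha0, ha1, hb0, hb1] at h1 h2 h3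
  constructor
  · linear_combination (-w z) * h1 + a z * h3 - b z * h2
  · linear_combination (-w' z) * h1 + a' z * h3 - b' z * h2

theorem Setting.exists_errSize_eq_zero (h : Setting Δ ψ E n v) (hΔ : IsSimplyConnected Δ)
    {p : ℂ} (hp : p ∈ Δ) :
    ∃ w w' : ℂ → ℂ, SolvesOn Δ (fun z => v ^ 2 + ψ z) w w' ∧ errSize ψ E n v w w' p = 0 := by
  obtain ⟨w, w', hw, hw', hS⟩ := exists_solvesOn h.isOpen hΔ
    ((differentiableOn_const (v ^ 2)).add h.diff) hp
    (Complex.exp (S E n v p) * Complex.exp (v * p))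
    (Complex.exp (S E n v p) * (v * Complex.exp (v * p)) +
      T ψ n v p / v * (Complex.exp (S E n v p) * Complex.exp (v * p)))
  refine ⟨w, w', hS, ?_⟩
  have he : Complex.exp (-S E n v p) * Complex.exp (S E n v p) = 1 := by
    rw [← Complex.exp_add]; simp
  have h0 : err E n v w p = 0 := by
    rw [err, hw]; linear_combination Complex.exp (v * p) * he
  have h1 : errDeriv ψ E n v w w' p = 0 := by
    rw [errDeriv, hw, hw']; linear_combination v * Complex.exp (v * p) * he
  simp [errSize, h0, h1]

/-- A solution is recovered from its error term. -/
theorem eq_of_err (w w' : ℂ → ℂ) (p : ℂ) :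
    w p = Complex.exp (S E n v p) * (err E n v w p + Complex.exp (v * p)) ∧
    w' p = Complex.exp (S E n v p) * (errDeriv ψ E n v w w' p + v * Complex.exp (v * p)) +
      T ψ n v p / v * w p := by
  have he : Complex.exp (S E n v p) * Complex.exp (-S E n v p) = 1 := by
    rw [← Complex.exp_add]; simp
  constructor
  · rw [err]; linear_combination -w p * he
  · rw [errDeriv]; linear_combination -(w' p - T ψ n v p / v * w p) * he

theorem Setting.exists_solution_of_point (h : Setting Δ ψ E n v) (hΔ : IsSimplyConnected Δ)
    {j : ℕ} {u : ℂ} (hu : (-1 : ℂ) ^ j * u = -v) {α : ℂ} (hα : α ∈ Δ) :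
    ∃ w w' : ℂ → ℂ, SolvesOn Δ (fun z => v ^ 2 + ψ z) w w' ∧
      ∀ ξ ∈ Δ, ∀ L : ProgressivePath Δ j u (.point α) ξ,
        errSize ψ E n v w w' ξ ≤ 1 / ‖v‖ ^ n * L.absIntegral (chi ψ n v) *
          Real.exp (4 / ‖v‖ * L.absIntegral (T ψ n v) +
            1 / ‖v‖ ^ n * L.absIntegral (chi ψ n v)) := by
  obtain ⟨w, w', hw, h0⟩ := h.exists_errSize_eq_zero hΔ hα
  refine ⟨w, w', hw, fun ξ _ L => ?_⟩
  cases L with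
  | fromPoint _ _ arcs chain =>
    have := h.errSize_chain hw hu arcs α ξ chain
    rw [h0, zero_add] at this
    exact this

/-- The threshold depends on the path alone, so for each path the estimate holds for all late
members of an approximating sequence. -/
theorem Setting.errSize_path_of_infinity (h : Setting Δ ψ E n v) {j : ℕ} {u : ℂ} (hu : (-1 : ℂ) ^ j * u = -v)
    (ℒ : InfiniteR2Arc) (hχ : IntegrableOn (ℒ.integrand (chi ψ n v)) (Ici 0))
    (hT : IntegrableOn (ℒ.integrand (T ψ n v)) (Ici 0)) {ξ : ℂ}
    (L : ProgressivePath Δ j u (.infinity ℒ) ξ) :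
    ∃ τ, ∀ K, τ ≤ K → ∀ w w' : ℂ → ℂ, SolvesOn Δ (fun z => v ^ 2 + ψ z) w w' →
      errSize ψ E n v w w' (ℒ.toFun K) = 0 →
      errSize ψ E n v w w' ξ ≤ 1 / ‖v‖ ^ n * L.absIntegral (chi ψ n v) *
          Real.exp (4 / ‖v‖ * L.absIntegral (T ψ n v) +
            1 / ‖v‖ ^ n * L.absIntegral (chi ψ n v)) := by
  cases L with
  | fromInfinity _ _ τ nonneg mem mono arcs chain =>
    refine ⟨τ, fun K hK w w' hw h0 => ?_⟩
    have h1 := h.errSize_tail hw hu ℒ nonneg hK mem mono hχ hT h0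
    have h2 := h.errSize_chain hw hu arcs _ ξ chain
    have hs : ∀ g : ℂ → ℂ, 0 ≤ (arcs.map fun γ => γ.absIntegral g).sum := fun g =>
      List.sum_nonneg (by
        simp only [List.mem_map, forall_exists_index, and_imp]
        rintro _ γ' - rfl
        exact γ'.absIntegral_nonneg _)
    have h3 := add_mul_exp_trans (integral_nonneg fun t => ℒ.integrand_nonneg _ t) (hs _)
      (integral_nonneg fun t => ℒ.integrand_nonneg _ t) (by positivity) (by positivity) h1 h2
    rw [zero_add] at h3
    exact h3

theorem Setting.exists_solution_of_infinity (h : Setting Δ ψ E n v) (hΔ : IsSimplyConnected Δ)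
    {j : ℕ} {u : ℂ} (hu : (-1 : ℂ) ^ j * u = -v) {ℒ : InfiniteR2Arc}
    (hℒ : ∀ τ ∈ Ici (0 : ℝ), ℒ.toFun τ ∈ Δ)
    (hχ : IntegrableOn (ℒ.integrand (chi ψ n v)) (Ici 0))
    (hT : IntegrableOn (ℒ.integrand (T ψ n v)) (Ici 0)) :
    ∃ w w' : ℂ → ℂ, SolvesOn Δ (fun z => v ^ 2 + ψ z) w w' ∧
      ∀ ξ ∈ Δ, ∀ L : ProgressivePath Δ j u (.infinity ℒ) ξ,
        errSize ψ E n v w w' ξ ≤ 1 / ‖v‖ ^ n * L.absIntegral (chi ψ n v) *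
          Real.exp (4 / ‖v‖ * L.absIntegral (T ψ n v) +
            1 / ‖v‖ ^ n * L.absIntegral (chi ψ n v)) := by
  -- A reachable point is needed to bound Cauchy data; if there is none, the estimate is vacuous and
  -- any solution serves.
  by_cases hex : ∃ p ∈ Δ, Nonempty (ProgressivePath Δ j u (.infinity ℒ) p)
  swap
  · obtain ⟨w, w', hw, -⟩ := h.exists_errSize_eq_zero hΔ (hℒ 0 self_mem_Ici)
    exact ⟨w, w', hw, fun ξ hξ L => absurd ⟨ξ, hξ, ⟨L⟩⟩ hex⟩
  obtain ⟨p, hp, ⟨L₀⟩⟩ := hex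
  have hv := h.ne_zero
  have hQ : DifferentiableOn ℂ (fun z => v ^ 2 + ψ z) Δ :=
    (differentiableOn_const (v ^ 2)).add h.diff
  have hconn : IsPreconnected Δ := hΔ.isPathConnected.isConnected.isPreconnected
  obtain ⟨a, a', ha0, ha1, ha⟩ := exists_solvesOn h.isOpen hΔ hQ hp 1 0
  obtain ⟨b, b', hb0, hb1, hb⟩ := exists_solvesOn h.isOpen hΔ hQ hp 0 1
  choose w w' hw hw0 using fun k : ℕ =>
    h.exists_errSize_eq_zero hΔ (hℒ (k : ℝ) (mem_Ici.2 (Nat.cast_nonneg k)))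
  have hbound : ∀ {ξ : ℂ} (L : ProgressivePath Δ j u (.infinity ℒ) ξ),
      ∀ᶠ k : ℕ in atTop, errSize ψ E n v (w k) (w' k) ξ ≤
        1 / ‖v‖ ^ n * L.absIntegral (chi ψ n v) * Real.exp (4 / ‖v‖ * L.absIntegral (T ψ n v) +
            1 / ‖v‖ ^ n * L.absIntegral (chi ψ n v)) := by
    intro ξ L
    obtain ⟨τ, hτ⟩ := h.errSize_path_of_infinity hu ℒ hχ hT L
    filter_upwards [tendsto_natCast_atTop_atTop.eventually_ge_atTop τ] with k hk
    exact hτ k hk _ _ (hw k) (hw0 k)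
  set R := 1 / ‖v‖ ^ n * L₀.absIntegral (chi ψ n v) * Real.exp (4 / ‖v‖ *
    L₀.absIntegral (T ψ n v) + 1 / ‖v‖ ^ n * L₀.absIntegral (chi ψ n v))
  set C := ‖Complex.exp (v * p)‖ * R
  have hball : ∃ᶠ k : ℕ in atTop, (err E n v (w k) p, errDeriv ψ E n v (w k) (w' k) p / v) ∈
      Metric.closedBall (0 : ℂ × ℂ) C := by
    refine ((hbound L₀).mono fun k hk => ?_).frequently
    rw [mem_closedBall_zero_iff, Prod.norm_def]
    exact (norm_err_le (w k) (w' k) p).trans (mul_le_mul_of_nonneg_left hk (norm_nonneg _))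
  -- The subsequence is chosen at `p`, before `ξ` and the path, so a single limiting solution serves
  -- all of them.
  obtain ⟨⟨e, d⟩, -, φ, hφ, hlim⟩ :=
    (isCompact_closedBall (0 : ℂ × ℂ) C).tendsto_subseq' hball
  have hφt := hφ.tendsto_atTop
  have he : Tendsto (fun k => err E n v (w (φ k)) p) atTop (𝓝 e) :=
    (continuous_fst.tendsto _).comp hlim
  have hd : Tendsto (fun k => errDeriv ψ E n v (w (φ k)) (w' (φ k)) p) atTop (𝓝 (d * v)) := by
    have := ((continuous_snd.tendsto _).comp hlim).mul_const v
    refine this.congr fun k => ?_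
    simp only [Function.comp]
    field_simp
  obtain ⟨c, hc⟩ : ∃ c, Tendsto (fun k => w (φ k) p) atTop (𝓝 c) :=
    ⟨_, ((he.add_const (Complex.exp (v * p))).const_mul (Complex.exp (S E n v p))).congr
      fun k => (eq_of_err (ψ := ψ) (w (φ k)) (w' (φ k)) p).1.symm⟩
  obtain ⟨c', hc'⟩ : ∃ c', Tendsto (fun k => w' (φ k) p) atTop (𝓝 c') :=
    ⟨_, (((hd.add_const (v * Complex.exp (v * p))).const_mul (Complex.exp (S E n v p))).add
      (hc.const_mul (T ψ n v p / v))).congr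
      fun k => (eq_of_err (w (φ k)) (w' (φ k)) p).2.symm⟩
  refine ⟨_, _, ha.combo hb c c', fun ξ hξ L => ?_⟩
  -- Solutions depend linearly on their data at `p`, so convergence there gives convergence at every
  -- point of `Δ`.
  have hw1 : Tendsto (fun k => w (φ k) ξ) atTop (𝓝 (c * a ξ + c' * b ξ)) :=
    Tendsto.congr (fun k => ((hw (φ k)).eq_combo h.isOpen hconn ha hb hp ha0 ha1 hb0 hb1
      hξ).1.symm) ((hc.mul_const _).add (hc'.mul_const _))
  have hw2 : Tendsto (fun k => w' (φ k) ξ) atTop (𝓝 (c * a' ξ + c' * b' ξ)) :=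
    Tendsto.congr (fun k => ((hw (φ k)).eq_combo h.isOpen hconn ha hb hp ha0 ha1 hb0 hb1
      hξ).2.symm) ((hc.mul_const _).add (hc'.mul_const _))
  have h1 := (hw1.const_mul (Complex.exp (-S E n v ξ))).sub_const (Complex.exp (v * ξ))
  have h2 := ((((hw2.sub (hw1.const_mul (T ψ n v ξ / v))).const_mul
    (Complex.exp (-S E n v ξ))).sub_const (v * Complex.exp (v * ξ)))).div_const v
  have h3 := ((h1.add h2).const_mul (Complex.exp (-(v * ξ)))).norm.max
    ((h1.sub h2).const_mul (Complex.exp (-(v * ξ)))).norm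
  exact le_of_tendsto h3 (hφt.eventually (hbound L))

theorem Setting.exists_solution (h : Setting Δ ψ E n v) (hΔ : IsSimplyConnected Δ)
    {j : ℕ} {u : ℂ} (hu : (-1 : ℂ) ^ j * u = -v) (α : BasePoint) (hα : α.IsIn Δ)
    (hχ : α.Converges (chi ψ n v)) (hT : α.Converges (T ψ n v)) :
    ∃ W ε : ℂ → ℂ, IsSolution Δ ψ v W ∧ DifferentiableOn ℂ ε Δ ∧
      (∀ ξ ∈ Δ, W ξ = Complex.exp (S E n v ξ) * (Complex.exp (v * ξ) + ε ξ)) ∧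
      ∀ ξ ∈ Xi Δ j u α, ∀ L : ProgressivePath Δ j u α ξ,
        max ‖ε ξ‖ ‖1 / v * deriv ε ξ‖ ≤
          ‖Complex.exp (v * ξ) / v ^ n‖ * L.absIntegral (chi ψ n v) *
            Real.exp (4 / ‖v‖ * L.absIntegral (T ψ n v) +
              1 / ‖v‖ ^ n * L.absIntegral (chi ψ n v)) := by
  obtain ⟨w, w', hw, hb⟩ : ∃ w w' : ℂ → ℂ, SolvesOn Δ (fun z => v ^ 2 + ψ z) w w' ∧
      ∀ ξ ∈ Δ, ∀ L : ProgressivePath Δ j u α ξ,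
        errSize ψ E n v w w' ξ ≤ 1 / ‖v‖ ^ n * L.absIntegral (chi ψ n v) *
          Real.exp (4 / ‖v‖ * L.absIntegral (T ψ n v) +
            1 / ‖v‖ ^ n * L.absIntegral (chi ψ n v)) := by
    cases α with
    | point α => exact h.exists_solution_of_point hΔ hu hα
    | infinity ℒ => exact h.exists_solution_of_infinity hΔ hu hα hχ hT
  have hε := fun ξ (hξ : ξ ∈ Δ) => h.hasDerivAt_err hw hξ
  refine ⟨w, err E n v w, ⟨fun z hz => (hw z hz).1.differentiableAt.differentiableWithinAt,
    fun z hz => ?_⟩, fun z hz => (hε z hz).differentiableAt.differentiableWithinAt,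
    fun z _ => ?_, fun ξ hξ L => ?_⟩
  · have : deriv w =ᶠ[𝓝 z] w' := by
      filter_upwards [h.isOpen.mem_nhds hz] with y hy using (hw y hy).1.deriv
    rw [this.deriv_eq, (hw z hz).2.deriv]
  · rw [(eq_of_err (E := E) (n := n) (v := v) (ψ := ψ) w w' z).1, add_comm]
  · rw [(hε ξ hξ.1).deriv, one_div_mul_eq_div]
    refine (norm_err_le w w' ξ).trans ((mul_le_mul_of_nonneg_left (hb ξ hξ.1 L)
      (norm_nonneg _)).trans_eq ?_)
    rw [norm_div, norm_pow]
    ring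

end

end LiouvilleGreen

/-! ### The theorem, from the cases `v = u` and `v = -u` -/

theorem theorem1p1
    (Δ : Set ℂ) (hΔ_open : IsOpen Δ) (hΔ : IsSimplyConnected Δ)
    (ψ : ℂ → ℂ) (hψ : AnalyticOnNhd ℂ ψ Δ)
    (E : ℕ → ℂ → ℂ)
    (hE : ∀ s : ℕ, 1 ≤ s → ∀ ξ ∈ Δ, HasDerivAt (E s) (LiouvilleGreen.F ψ s ξ) ξ)
    (u : ℂ) (hu : u ≠ 0) (n : ℕ) (hn : 1 ≤ n)
    (α₁ α₂ : LiouvilleGreen.BasePoint) (hα₁ : α₁.IsIn Δ) (hα₂ : α₂.IsIn Δ)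
    (hχ₁ : α₁.Converges (LiouvilleGreen.chi ψ n u))
    (hT₁ : α₁.Converges (LiouvilleGreen.T ψ n u))
    (hχ₂ : α₂.Converges (LiouvilleGreen.chi ψ n (-u)))
    (hT₂ : α₂.Converges (LiouvilleGreen.T ψ n (-u))) :
    -- the two expressions for `T_n` agree
    (∀ v : ℂ, v ≠ 0 → ∀ ξ ∈ Δ,
      LiouvilleGreen.T ψ n v ξ = v * deriv (LiouvilleGreen.S E n v) ξ) ∧
    -- the solution `W_{n,1}`
    (∃ W ε : ℂ → ℂ,
      LiouvilleGreen.IsSolution Δ ψ u W ∧ DifferentiableOn ℂ ε Δ ∧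
      (∀ ξ ∈ Δ, W ξ =
        Complex.exp (LiouvilleGreen.S E n u ξ) * (Complex.exp (u * ξ) + ε ξ)) ∧
      ∀ ξ ∈ LiouvilleGreen.Xi Δ 1 u α₁, ∀ L : LiouvilleGreen.ProgressivePath Δ 1 u α₁ ξ,
        max ‖ε ξ‖ ‖1 / u * deriv ε ξ‖ ≤
          ‖Complex.exp (u * ξ) / u ^ n‖ * L.absIntegral (LiouvilleGreen.chi ψ n u) *
            Real.exp (4 / ‖u‖ * L.absIntegral (LiouvilleGreen.T ψ n u) +
              1 / ‖u‖ ^ n * L.absIntegral (LiouvilleGreen.chi ψ n u))) ∧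
    -- the solution `W_{n,2}`
    (∃ W ε : ℂ → ℂ,
      LiouvilleGreen.IsSolution Δ ψ u W ∧ DifferentiableOn ℂ ε Δ ∧
      (∀ ξ ∈ Δ, W ξ =
        Complex.exp (LiouvilleGreen.S E n (-u) ξ) * (Complex.exp (-u * ξ) + ε ξ)) ∧
      ∀ ξ ∈ LiouvilleGreen.Xi Δ 2 u α₂, ∀ L : LiouvilleGreen.ProgressivePath Δ 2 u α₂ ξ,
        max ‖ε ξ‖ ‖1 / u * deriv ε ξ‖ ≤
          ‖Complex.exp (-u * ξ) / u ^ n‖ * L.absIntegral (LiouvilleGreen.chi ψ n (-u)) *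
            Real.exp (4 / ‖u‖ * L.absIntegral (LiouvilleGreen.T ψ n (-u)) +
              1 / ‖u‖ ^ n * L.absIntegral (LiouvilleGreen.chi ψ n (-u)))) := by
  have hψd : DifferentiableOn ℂ ψ Δ := hψ.differentiableOn
  refine ⟨fun v hv ξ hξ => ?_, ?_, ?_⟩
  · rw [(LiouvilleGreen.hasDerivAt_S (fun s hs => hE s hs ξ hξ) hn v).deriv]
    field_simp
  · exact LiouvilleGreen.Setting.exists_solution ⟨hΔ_open, hψd, hE, hn, hu⟩ hΔ (by simp) α₁ hα₁
      hχ₁ hT₁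
  · obtain ⟨W, ε, h1, h2, h3, h4⟩ := LiouvilleGreen.Setting.exists_solution (j := 2) (u := u)
      ⟨hΔ_open, hψd, hE, hn, neg_ne_zero.2 hu⟩ hΔ (by simp) α₂ hα₂ hχ₂ hT₂
    refine ⟨W, ε, ⟨h1.1, fun ξ hξ => by rw [h1.2 ξ hξ, neg_sq]⟩, h2, h3, fun ξ hξ L => ?_⟩
    have := h4 ξ hξ L
    simpa only [norm_mul, norm_div, norm_pow, norm_neg] using this
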